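/- **Model.** Fix real parameters $P_S,\sigma^2,d_{SD},d_{SR},d_{RD},R_0,M,\lambda_1>0$ and $\alpha\in\mathbb R$. Let $\Gamma_{th}=2^{2R_0}-1$, and let $\Gamma'_{th}=\Gamma_{th}$ (incremental signalling) or $\Gamma'_{th}=\infty$ (non-incremental signalling, with $e^{-\infty}=0$). In signalling intervals $i=0,1,2,\dots$ the channels $h_{SD}(i)\sim\mathcal{CN}(0,d_{SD}^{-\alpha})$, $h_{SR}(i)\sim\mathcal{CN}(0,d_{SR}^{-\alpha})$, $h_{RD}(i)\sim\mathcal{CN}(0,d_{RD}^{-\alpha})$ and the harvested energies $X(i)\sim\mathrm{Exp}(\lambda_1)$ are all mutually independent, and independent of the initial energy $B(0)\ge 0$, which is otherwise arbitrary. Put $\gamma_{SD}(i)=P_S|h_{SD}(i)|^2/\sigma^2$ and $\gamma_{SR}(i)=P_S|h_{SR}(i)|^2/\sigma^2$. The energy in the infinite-size buffer, operated by the incremental best-effort policy (IBEP), evolves by $$B(i+1)=\begin{cases}B(i)+X(i),&\gamma_{SD}(i)\ge\Gamma'_{th},\\ B(i)-M+X(i),&\gamma_{SD}(i)<\Gamma'_{th},\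 B(i)\ge M,\\ X(i),&\gamma_{SD}(i)<\Gamma'_{th},\ B(i)<M.\end{cases}$$ If the relay transmits with power $P_R(i)$, put $\gamma_{RD}(i)=P_R(i)|h_{RD}(i)|^2/\sigma^2$; the outage probability in interval $i$ is $$P_{out}(i)=\Pr\{\gamma_{SD}(i)<\Gamma'_{th}\}\,\Pr\{\min(\gamma_{SR}(i),\gamma_{RD}(i)+\gamma_{SD}(i))<\Gamma_{th}\mid\gamma_{SD}(i)<\Gamma'_{th}\}.$$ Under the policy, $P_R(i)=2\min(B(i),M)$. Let $$W_1=\frac{\sigma^2d_{RD}^\alpha}{2M},\quad W_2=\frac{\sigma^2d_{SD}^\alpha}{P_S},\quad W_3=\frac{\sigma^2d_{RD}^\alpha}{2},\quad W_4=\frac{\sigma^2d_{SR}^\alpha}{P_S},\quad \phi_{inc}=M\lambda_1(1-e^{-W_2\Gamma'_{th}}),$$ $$Z_1=\frac{\mathcal W(-\phi_{inc}e^{-\phi_{inc}})+\phi_{inc}}{M},\qquad I_{HSU}=W_2Z_1\int_0^M\frac{x e^{-Z_1x}\left[e^{-W_2\Gamma_{th}}-e^{-W_3\Gamma_{th}/x}\right]}{xW_2-W_3}\,dx,$$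 where $\mathcal W$ is the principal branch of the Lambert function, and assume $W_1\ne W_2$. **Theorem 5.** 1. Let $\phi_{inc}>1$. Then the integrand of $I_{HSU}$ is integrable on $(0,M)$, and with $$P_{out}^{HSU}=(1-e^{-W_4\Gamma_{th}})(1-e^{-W_2\Gamma'_{th}})+e^{-W_4\Gamma_{th}}\Big[e^{-Z_1M}\Big\{(1-e^{-W_2\Gamma_{th}})+\frac{W_2[e^{-W_1\Gamma_{th}}-e^{-W_2\Gamma_{th}}]}{W_1-W_2}\Big\}+(1-e^{-Z_1M})(1-e^{-W_2\Gamma_{th}})+I_{HSU}\Big]$$ the following holds. The outage probability under the policy in steady state is $P_{out}^{HSU}$: one has $P_{out}(i)=P_{out}^{HSU}$ for every $i$ such that $B(i+1)$ and $B(i)$ have the same law, and $\lim_{i\to\infty}P_{out}(i)=P_{out}^{HSU}$ for every law of $B(0)$. 2. Let $\phi_{inc}\le1$, and let $$P_{out}^{HSU}=(1-e^{-W_4\Gamma_{th}})(1-e^{-W_2\Gamma'_{th}})+e^{-W_4\Gamma_{th}}\Big\{(1-e^{-W_2\Gamma_{th}})+\frac{W_2[e^{-W_1\Gamma_{th}}-e^{-W_2\Gamma_{th}}]}{W_1-W_2}\Big\}.$$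 With the relay power fixed at $P_R(i)=2M$, the outage probability in every interval is $P_{out}^{HSU}$. Under the policy, $\lim_{i\to\infty}P_{out}(i)=P_{out}^{HSU}$ for every law of $B(0)$. -/

import Mathlib

open MeasureTheory ProbabilityTheory Filter Topology

/-- The circularly symmetric complex Gaussian law `CN(0, v)`: real and imaginary part are
independent centred real Gaussians of variance `v / 2` each. -/
noncomputable def complexGaussian (v : NNReal) : Measure ℂ :=
  ((gaussianReal 0 (v / 2)).prod (gaussianReal 0 (v / 2))).map Complex.measurableEquivRealProd.symm

/-- The principal real branch of the Lambert function: for `x ≥ -exp (-1)` it is the unique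
`w ≥ -1` with `w * exp w = x` (no meaning is attached to other `x`). -/
noncomputable def lambertW (x : ℝ) : ℝ :=
  Function.invFunOn (fun w : ℝ => w * Real.exp w) (Set.Ici (-1)) x

/-- Incremental signalling, or non-incremental signalling (a NACK is always sent). -/
inductive Signalling where
  | incremental
  | nonIncremental

/-- The deterministic parameters of the relay network. -/
structure RelayParams where
  /-- incremental or non-incremental signalling -/
  signalling : Signalling
  /-- source power `P_S` -/
  PS : ℝ
  /-- noise variance `σ²` -/
  noiseVar : ℝ
  /-- normalized distance source - destination -/
  dSD : ℝ
  /-- normalized distance source - relay -/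
  dSR : ℝ
  /-- normalized distance relay - destination -/
  dRD : ℝ
  /-- path-loss exponent -/
  α : ℝ
  /-- target rate `R₀` -/
  R0 : ℝ
  /-- energy drawn from the buffer for a relay transmission -/
  M : ℝ
  /-- rate `λ₁` of the exponentially distributed harvested energy, `E[X] = 1 / λ₁` -/
  lam1 : ℝ
  PS_pos : 0 < PS
  noiseVar_pos : 0 < noiseVar
  dSD_pos : 0 < dSD
  dSR_pos : 0 < dSR
  dRD_pos : 0 < dRD
  R0_pos : 0 < R0
  M_pos : 0 < M
  lam1_pos : 0 < lam1

namespace RelayParams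

variable (p : RelayParams)

/-- The SNR threshold `Γ_th = 2 ^ (2 R₀) - 1`. -/
noncomputable def Gth : ℝ := (2 : ℝ) ^ (2 * p.R0) - 1

/-- The threshold `Γ'_th`: equal to `Γ_th` for incremental and to `∞` for non-incremental
signalling. -/
noncomputable def Gth' : EReal :=
  match p.signalling with
  | Signalling.incremental => (p.Gth : EReal)
  | Signalling.nonIncremental => ⊤

noncomputable def W1 : ℝ := p.noiseVar * p.dRD ^ p.α / (2 * p.M)

noncomputable def W2 : ℝ := p.noiseVar * p.dSD ^ p.α / p.PS

noncomputable def W3 : ℝ := p.noiseVar * p.dRD ^ p.α / 2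

noncomputable def W4 : ℝ := p.noiseVar * p.dSR ^ p.α / p.PS

/-- The number `exp (- W₂ Γ'_th)`, with `exp (-∞) = 0`. -/
noncomputable def expNegW2Gth' : ℝ := (EReal.exp (-((p.W2 : EReal) * p.Gth'))).toReal

/-- `φ_inc = M (1 - exp (- W₂ Γ'_th)) / E[X] = M λ₁ (1 - exp (- W₂ Γ'_th))`. -/
noncomputable def phiInc : ℝ := p.M * p.lam1 * (1 - p.expNegW2Gth')

/-- The rate `Z₁` of the limiting exponential law of the stored energy. -/
noncomputable def Z1 : ℝ :=
  lambertW (-((1 - p.expNegW2Gth') * p.lam1 * p.M) *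
      Real.exp (-((1 - p.expNegW2Gth') * p.lam1 * p.M))) / p.M
    + (1 - p.expNegW2Gth') * p.lam1

/-- The integrand of `I_HSU`. -/
noncomputable def integrandHSU (x : ℝ) : ℝ :=
  x * Real.exp (-(p.Z1 * x)) * (Real.exp (-(p.W2 * p.Gth)) - Real.exp (-(p.W3 * p.Gth / x)))
    / (x * p.W2 - p.W3)

/-- The one-dimensional integral `I_HSU`. -/
noncomputable def IHSU : ℝ := p.W2 * p.Z1 * ∫ x in (0 : ℝ)..p.M, p.integrandHSU x

end RelayParams

/-- The random inputs of the network on a probability space `(Ω, P)`: Rayleigh fading channels and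
harvested energies in the signalling intervals `i = 0, 1, 2, …`, and the initial energy in the
buffer. In each interval the three channels and the harvested energy are mutually independent with
laws `CN(0, d_SD^(-α))`, `CN(0, d_SR^(-α))`, `CN(0, d_RD^(-α))`, `Exp(λ₁)`; different
intervals are independent, and the initial energy is independent of all of them. -/
structure RelayModel (p : RelayParams) {Ω : Type*} [MeasurableSpace Ω] (P : Measure Ω) where
  hSD : ℕ → Ω → ℂ
  hSR : ℕ → Ω → ℂ
  hRD : ℕ → Ω → ℂ
  /-- harvested energy -/
  X : ℕ → Ω → ℝ
  /-- initial energy in the buffer -/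
  B0 : Ω → ℝ
  measurable_hSD : ∀ i, Measurable (hSD i)
  measurable_hSR : ∀ i, Measurable (hSR i)
  measurable_hRD : ∀ i, Measurable (hRD i)
  measurable_X : ∀ i, Measurable (X i)
  measurable_B0 : Measurable B0
  B0_nonneg : ∀ᵐ ω ∂P, 0 ≤ B0 ω
  law_slot : ∀ i, P.map (fun ω => (hSD i ω, hSR i ω, hRD i ω, X i ω)) =
    (complexGaussian (p.dSD ^ (-p.α)).toNNReal).prod
      ((complexGaussian (p.dSR ^ (-p.α)).toNNReal).prod
        ((complexGaussian (p.dRD ^ (-p.α)).toNNReal).prod (expMeasure p.lam1)))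
  indep_slots : iIndepFun (fun i ω => (hSD i ω, hSR i ω, hRD i ω, X i ω)) P
  indep_initial : IndepFun B0 (fun ω i => (hSD i ω, hSR i ω, hRD i ω, X i ω)) P

namespace RelayModel

variable {p : RelayParams} {Ω : Type*} [MeasurableSpace Ω] {P : Measure Ω} (m : RelayModel p P)

/-- `γ_SD(i) = P_S |h_SD(i)|² / σ²`. -/
noncomputable def snrSD (i : ℕ) (ω : Ω) : ℝ := p.PS * ‖m.hSD i ω‖ ^ 2 / p.noiseVar

/-- `γ_SR(i) = P_S |h_SR(i)|² / σ²`. -/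
noncomputable def snrSR (i : ℕ) (ω : Ω) : ℝ := p.PS * ‖m.hSR i ω‖ ^ 2 / p.noiseVar

/-- `γ_RD(i) = P_R(i) |h_RD(i)|² / σ²` for the relay power `PR ω = P_R(i)`. -/
noncomputable def snrRD (PR : Ω → ℝ) (i : ℕ) (ω : Ω) : ℝ :=
  PR ω * ‖m.hRD i ω‖ ^ 2 / p.noiseVar

open Classical in
/-- The energy `B(i)` in the infinite-size buffer under the incremental best-effort policy. -/
noncomputable def energy : ℕ → Ω → ℝ
  | 0 => m.B0
  | i + 1 => fun ω =>
      if p.Gth' ≤ (m.snrSD i ω : EReal) then energy i ω + m.X i ω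
      else if p.M ≤ energy i ω then energy i ω - p.M + m.X i ω
      else m.X i ω

/-- The transmit power of the relay under the best-effort policy: the energy `min (B(i), M)`
is spent in a phase of duration `1 / 2`. -/
noncomputable def relayPower (i : ℕ) (ω : Ω) : ℝ := min (m.energy i ω) p.M / (1 / 2)

/-- The direct link fails (a NACK is sent) in interval `i`: `γ_SD(i) < Γ'_th`. -/
def nackEvent (i : ℕ) : Set Ω := {ω | (m.snrSD i ω : EReal) < p.Gth'}

/-- The outage probability of incremental decode-and-forward relaying in interval `i` when the
relay transmits with power `PR`:
`Pr{γ_SD < Γ'_th} · Pr{min (γ_SR, γ_RD + γ_SD) < Γ_th | γ_SD < Γ'_th}`. -/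
noncomputable def outageProb (PR : Ω → ℝ) (i : ℕ) : ℝ :=
  P.real (m.nackEvent i) *
    (cond P (m.nackEvent i)).real
      {ω | min (m.snrSR i ω) (m.snrRD PR i ω + m.snrSD i ω) < p.Gth}

end RelayModel

/-! Failure of the direct link in interval `i` depends only on the inputs of that interval, which
are independent of `B(i)`. Hence the stored energy is a Markov chain on `[0, ∞)`: with `q =
nackProb`, it moves from `b` to `b + X` with probability `1 - q` and to `max (b - M) 0 + X` with
probability `q` (`map_energy`). The outage probability in interval `i` is the integral of one
bounded function, `bufferOutage`, against the law of `B(i)` (`outageProb_relayPower`). It remains to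
find the limit of these integrals and to evaluate it.

If `φ_inc > 1`, the mean energy drawn from a full enough buffer exceeds the mean harvest. By
memorylessness, `Exp(z)` is stationary when `z = λ₁ q (1 - exp (-z M))` (`stepLaw_expMeasure`), and
`Z₁` is the positive root (`Z1_spec`). Two copies of the chain with the same inputs and different
starts keep their order and coincide once the fuller one is drained; an exponential moment makes
their expectations merge geometrically (`abs_iterate_stepOp_sub_le`). This gives convergence from
every initial law, and hence uniqueness of the stationary law.

If `φ_inc ≤ 1`, no limiting law is sought; it suffices that the deficit `(M - B)⁺` tends to `0` in
mean. The drift of `exp (-θ B)` bounds the mean deficit by a decrement of `E exp (-θ B)` plus an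
error of order `θ` (`stepOp_exp_le`). From the empty buffer these expectations decrease, so their
decrements vanish, and then `θ` is made small. The empty start is the worst one by monotonicity.
Since `bufferOutage` is continuous at `M` and constant above it, the limit is `bufferOutage M`.

The closed forms come from the law of a sum of two exponential variables and from splitting the
integral against `Exp(Z₁)` at `M`. -/

/-! ### The exponential law -/

section Exponential

/-- Integration against the exponential law. -/
theorem integral_expMeasure {E : Type*} [NormedAddCommGroup E] [NormedSpace ℝ E] {r : ℝ}
    (hr : 0 < r) (f : ℝ → E) :
    ∫ x, f x ∂(expMeasure r) = ∫ x in Set.Ioi (0 : ℝ), (r * Real.exp (-(r * x))) • f x := by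
  have h1 : expMeasure r = volume.withDensity
      (fun x => ENNReal.ofReal (exponentialPDFReal r x)) := rfl
  rw [h1, integral_withDensity_eq_integral_toReal_smul (by fun_prop)
    (Eventually.of_forall fun _ => ENNReal.ofReal_lt_top), ← integral_Ici_eq_integral_Ioi,
    ← integral_indicator measurableSet_Ici]
  refine integral_congr_ae (Eventually.of_forall fun x => ?_)
  beta_reduce
  rw [ENNReal.toReal_ofReal (exponentialPDFReal_nonneg hr x)]
  simp only [exponentialPDFReal, gammaPDFReal, Set.indicator_apply, Set.mem_Ici]
  split_ifs <;> simp

theorem expMeasure_absolutelyContinuous (r : ℝ) : expMeasure r ≪ volume :=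
  withDensity_absolutelyContinuous _ _

theorem expMeasure_Iio_zero (r : ℝ) : expMeasure r (Set.Iio 0) = 0 := by
  have h1 : expMeasure r = volume.withDensity (exponentialPDF r) := rfl
  rw [h1, withDensity_apply _ measurableSet_Iio, lintegral_exponentialPDF_of_nonpos le_rfl]

theorem expMeasure_ae_pos (r : ℝ) : ∀ᵐ x ∂(expMeasure r), 0 < x := by
  have h0 : expMeasure r {0} = 0 := expMeasure_absolutelyContinuous r (by simp)
  have h : expMeasure r (Set.Iic 0) = 0 := by
    rw [← Set.Iio_union_right]
    exact measure_union_null (expMeasure_Iio_zero r) h0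
  simpa [ae_iff, Set.Iic] using h

theorem expMeasure_real_Iio {r : ℝ} (hr : 0 < r) {t : ℝ} (ht : 0 ≤ t) :
    (expMeasure r).real (Set.Iio t) = 1 - Real.exp (-(r * t)) := by
  have := isProbabilityMeasure_expMeasure hr
  have h1 : (expMeasure r).real (Set.Iic t) = 1 - Real.exp (-(r * t)) := by
    rw [← cdf_eq_real, cdf_expMeasure_eq hr, if_pos ht]
  rw [← h1]
  refine measureReal_congr ?_
  have h0 : expMeasure r {t} = 0 := expMeasure_absolutelyContinuous r (by simp)
  have : ∀ᵐ x ∂(expMeasure r), x ≠ t := by simpa [ae_iff] using h0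
  filter_upwards [this] with x hx
  simp only [eq_iff_iff]
  exact (lt_iff_le_and_ne.trans (and_iff_left hx))

open Complex in
theorem charFun_expMeasure {r : ℝ} (hr : 0 < r) (t : ℝ) :
    charFun (expMeasure r) t = r / (r - t * I) := by
  rw [charFun_apply_real, integral_expMeasure hr]
  have h (x : ℝ) : (r * Real.exp (-(r * x))) • cexp (t * x * I)
      = r * cexp ((t * I - r) * x) := by
    rw [Complex.real_smul]
    push_cast
    rw [mul_assoc, ← Complex.exp_add]
    ring_nf
  simp_rw [h]
  rw [integral_const_mul, integral_exp_mul_complex_Ioi (by simpa using hr)]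
  have h2 : (r : ℂ) - t * I ≠ 0 := fun h => hr.ne' (by simpa using congrArg Complex.re h)
  have h3 : (t : ℂ) * I - r ≠ 0 := fun h => h2 (by linear_combination -h)
  simp only [ofReal_zero, mul_zero, Complex.exp_zero]
  field_simp
  ring

open Complex in
theorem expMeasure_map_mul {r c : ℝ} (hr : 0 < r) (hc : 0 < c) :
    (expMeasure r).map (fun x => c * x) = expMeasure (r / c) := by
  have := isProbabilityMeasure_expMeasure hr
  have := isProbabilityMeasure_expMeasure (div_pos hr hc)
  have : IsProbabilityMeasure ((expMeasure r).map (fun x => c * x)) :=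
    Measure.isProbabilityMeasure_map (by fun_prop)
  refine Measure.ext_of_charFun (funext fun t => ?_)
  rw [charFun_map_mul, charFun_expMeasure hr, charFun_expMeasure (div_pos hr hc)]
  push_cast
  have hc' : (c : ℂ) ≠ 0 := ofReal_ne_zero.mpr hc.ne'
  have h2 : (r : ℂ) - c * t * I ≠ 0 := fun h => hr.ne' (by simpa using congrArg Complex.re h)
  have h3 : (r : ℂ) / c - t * I ≠ 0 := fun h => h2 (by field_simp at h; linear_combination h)
  rw [div_eq_div_iff h2 h3]
  field_simp

theorem integrable_of_bounded {α : Type*} [MeasurableSpace α] {μ : Measure α} [IsFiniteMeasure μ]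
    {f : α → ℝ} (hf : Measurable f) {C : ℝ} (hC : ∀ x, |f x| ≤ C) : Integrable f μ :=
  Integrable.of_bound hf.aestronglyMeasurable C (Eventually.of_forall hC)

theorem prod_real_apply {α β : Type*} [MeasurableSpace α] [MeasurableSpace β] {μ : Measure α}
    {ν : Measure β} [IsFiniteMeasure ν] {s : Set (α × β)} (hs : MeasurableSet s) :
    (μ.prod ν).real s = ∫ x, ν.real (Prod.mk x ⁻¹' s) ∂μ := by
  rw [measureReal_def, Measure.prod_apply hs, integral_eq_lintegral_of_nonneg_ae
    (Eventually.of_forall fun x => measureReal_nonneg)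
    (measurable_measure_prodMk_left hs).ennreal_toReal.aestronglyMeasurable]
  congr 1
  refine lintegral_congr fun x => ?_
  rw [measureReal_def, ENNReal.ofReal_toReal (measure_ne_top _ _)]

/-- The distribution function of a sum of two independent exponential variables. -/
theorem expMeasure_prod_real_add_lt {a b t : ℝ} (ha : 0 < a) (hb : 0 < b) (hab : b ≠ a)
    (ht : 0 ≤ t) :
    ((expMeasure a).prod (expMeasure b)).real {z : ℝ × ℝ | z.2 + z.1 < t}
      = (1 - Real.exp (-(a * t)))
        + a * (Real.exp (-(b * t)) - Real.exp (-(a * t))) / (b - a) := by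
  have := isProbabilityMeasure_expMeasure ha
  have := isProbabilityMeasure_expMeasure hb
  have hm : MeasurableSet {z : ℝ × ℝ | z.2 + z.1 < t} :=
    measurableSet_lt (by fun_prop) (by fun_prop)
  have h1 : ((expMeasure a).prod (expMeasure b)).real {z : ℝ × ℝ | z.2 + z.1 < t}
      = ∫ x, (expMeasure b).real (Set.Iio (t - x)) ∂(expMeasure a) := by
    rw [prod_real_apply hm]
    congr 1
    ext x
    congr 1
    ext y
    simp [lt_sub_iff_add_lt]
  rw [h1, integral_expMeasure ha]
  -- For `x > t` the second variable would have to be negative, so only `(0, t]` contributes.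
  have h2 : ∫ x in Set.Ioi (0 : ℝ), (a * Real.exp (-(a * x))) •
        (expMeasure b).real (Set.Iio (t - x))
      = ∫ x in Set.Ioc 0 t, a * Real.exp (-(a * x)) * (1 - Real.exp (-(b * (t - x)))) := by
    rw [← integral_indicator measurableSet_Ioi, ← integral_indicator measurableSet_Ioc]
    congr 1
    ext x
    simp only [Set.indicator_apply, Set.mem_Ioi, Set.mem_Ioc, smul_eq_mul]
    by_cases hx : 0 < x
    · by_cases hxt : x ≤ t
      · simp only [hx, hxt, if_true, and_self]
        rw [expMeasure_real_Iio hb (sub_nonneg.mpr hxt)]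
      · have : (expMeasure b).real (Set.Iio (t - x)) = 0 := by
          have h0 := expMeasure_Iio_zero b
          rw [measureReal_def, measure_mono_null (Set.Iio_subset_Iio (by linarith)) h0]
          simp
        simp [hx, hxt, this]
    · simp [hx]
  rw [h2, ← intervalIntegral.integral_of_le ht]
  have hab' : b - a ≠ 0 := sub_ne_zero.mpr hab
  have hderiv : ∀ x ∈ Set.uIcc 0 t, HasDerivAt
      (fun x => -Real.exp (-(a * x)) - a * Real.exp (-(b * t) + (b - a) * x) / (b - a))
      (a * Real.exp (-(a * x)) * (1 - Real.exp (-(b * (t - x))))) x := by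
    intro x _
    have e1 : HasDerivAt (fun x : ℝ => -(a * x)) (-a) x := by
      simpa using ((hasDerivAt_id x).const_mul a).fun_neg
    have e2 : HasDerivAt (fun x : ℝ => -(b * t) + (b - a) * x) (b - a) x := by
      simpa using ((hasDerivAt_id x).const_mul (b - a)).const_add (-(b * t))
    have e3 := e1.exp.neg.sub ((e2.exp.const_mul a).div_const (b - a))
    convert! e3 using 1
    have : Real.exp (-(b * t) + (b - a) * x)
        = Real.exp (-(a * x)) * Real.exp (-(b * (t - x))) := by
      rw [← Real.exp_add]; ring_nf
    rw [this]
    field_simp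
  rw [intervalIntegral.integral_eq_sub_of_hasDerivAt hderiv
    (Continuous.intervalIntegrable (by fun_prop) _ _)]
  have e : -(b * t) + (b - a) * t = -(a * t) := by ring
  simp only [e, mul_zero, add_zero, neg_zero, Real.exp_zero]
  field_simp
  ring

end Exponential

/-! ### Rayleigh fading -/

section Rayleigh

instance isProbabilityMeasure_complexGaussian (v : NNReal) :
    IsProbabilityMeasure (complexGaussian v) :=
  Measure.isProbabilityMeasure_map (by fun_prop)

-- The square is what is needed, one factor each for the real and the imaginary part. It also
-- removes the complex square root of the Gaussian integral, so no branch has to be discussed.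
open Complex in
theorem integral_cexp_mul_sq_gaussianReal {v : NNReal} (hv : 0 < v) (t : ℝ) :
    (∫ x, cexp (t * (x ^ 2 : ℝ) * I) ∂(gaussianReal 0 (v / 2))) ^ 2
      = ((v : ℝ)⁻¹ : ℝ) / (((v : ℝ)⁻¹ : ℝ) - t * I) := by
  have hv' : (0 : ℝ) < v := hv
  rw [integral_gaussianReal_eq_integral_smul (by positivity)]
  have hb : 0 < (((v : ℝ)⁻¹ : ℝ) - t * I : ℂ).re := by simpa using hv'
  have h (x : ℝ) : gaussianPDFReal 0 (v / 2) x • cexp (t * (x ^ 2 : ℝ) * I)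
      = ((√(Real.pi * v))⁻¹ : ℝ) * cexp (-(((v : ℝ)⁻¹ : ℝ) - t * I) * x ^ 2) := by
    rw [gaussianPDFReal, Complex.real_smul]
    push_cast
    rw [mul_assoc, ← Complex.exp_add]
    congr 1
    · congr 3
      ring_nf
    · congr 1
      have : (v : ℂ) ≠ 0 := ofReal_ne_zero.mpr hv'.ne'
      field_simp
      ring
  simp_rw [h]
  rw [integral_const_mul, integral_gaussian_complex hb, mul_pow, ← Complex.cpow_nat_mul]
  have hb0 : (((v : ℝ)⁻¹ : ℝ) - t * I : ℂ) ≠ 0 := fun h => by rw [h] at hb; simp at hb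
  have hs : (((√(Real.pi * v))⁻¹ : ℝ) : ℂ) ^ 2 = ((Real.pi * v)⁻¹ : ℝ) := by
    rw [← ofReal_pow, inv_pow, Real.sq_sqrt (by positivity)]
  rw [hs]
  norm_num
  have : (v : ℂ) ≠ 0 := ofReal_ne_zero.mpr hv'.ne'
  have : (Real.pi : ℂ) ≠ 0 := ofReal_ne_zero.mpr Real.pi_ne_zero
  push_cast at hb0
  field_simp

open Complex in
/-- The squared modulus of a circularly symmetric complex Gaussian variable is exponential. -/
theorem complexGaussian_map_norm_sq {v : NNReal} (hv : 0 < v) :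
    (complexGaussian v).map (fun z => ‖z‖ ^ 2) = expMeasure (v : ℝ)⁻¹ := by
  have hv' : (0 : ℝ) < (v : ℝ)⁻¹ := inv_pos.mpr hv
  have := isProbabilityMeasure_expMeasure hv'
  have : IsProbabilityMeasure ((complexGaussian v).map (fun z => ‖z‖ ^ 2)) :=
    Measure.isProbabilityMeasure_map (by fun_prop)
  refine Measure.ext_of_charFun (funext fun t => ?_)
  rw [charFun_expMeasure hv', ← integral_cexp_mul_sq_gaussianReal hv, charFun_apply_real,
    complexGaussian, Measure.map_map (by fun_prop) (by fun_prop),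
    integral_map (by fun_prop) (by fun_prop), sq, ← integral_prod_mul]
  congr 1
  ext z
  rw [← Complex.exp_add]
  simp only [Function.comp_apply, Complex.sq_norm, Complex.normSq_apply,
    Complex.measurableEquivRealProd_symm_apply]
  push_cast
  ring_nf

end Rayleigh

/-! ### The transition operator of the energy buffer -/

section Step

/-- The transition operator of the buffer: energy `M` (or everything, if there is less) is drawn
with probability `q`, and then an amount of law `ε` is added. -/
noncomputable def stepOp (q M : ℝ) (ε : Measure ℝ) (f : ℝ → ℝ) (b : ℝ) : ℝ :=
  (1 - q) * ∫ x, f (b + x) ∂ε + q * ∫ x, f (max (b - M) 0 + x) ∂ε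

/-- The law of the energy in the buffer one interval later. -/
noncomputable def stepLaw (q M : ℝ) (ε ν : Measure ℝ) : Measure ℝ :=
  (1 - q).toNNReal • (ν ∗ ε) + q.toNNReal • ((ν.map fun b => max (b - M) 0) ∗ ε)

variable {q M : ℝ} {ε : Measure ℝ} [IsProbabilityMeasure ε]

theorem measurable_stepOp {f : ℝ → ℝ} (hf : Measurable f) : Measurable (stepOp q M ε f) := by
  have h1 : StronglyMeasurable fun b => ∫ x, f (b + x) ∂ε :=
    StronglyMeasurable.integral_prod_right (f := fun b x => f (b + x))
      (by apply Measurable.stronglyMeasurable; fun_prop)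
  have h2 : StronglyMeasurable fun b => ∫ x, f (max (b - M) 0 + x) ∂ε :=
    StronglyMeasurable.integral_prod_right (f := fun b x => f (max (b - M) 0 + x))
      (by apply Measurable.stronglyMeasurable; fun_prop)
  exact (h1.measurable.const_mul _).add (h2.measurable.const_mul _)

theorem abs_integral_le_of_bounded {α : Type*} [MeasurableSpace α] {μ : Measure α}
    [IsProbabilityMeasure μ] {f : α → ℝ} {C : ℝ} (hC : ∀ x, |f x| ≤ C) :
    |∫ x, f x ∂μ| ≤ C := by
  have h : ∀ᵐ x ∂μ, ‖f x‖ ≤ C := Eventually.of_forall hC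
  simpa using norm_integral_le_of_norm_le_const h

theorem abs_stepOp_le (hq0 : 0 ≤ q) (hq1 : q ≤ 1) {f : ℝ → ℝ} {C : ℝ} (hC : ∀ x, |f x| ≤ C)
    (b : ℝ) : |stepOp q M ε f b| ≤ C := by
  have h1 : |∫ x, f (b + x) ∂ε| ≤ C := abs_integral_le_of_bounded fun x => hC _
  have h2 : |∫ x, f (max (b - M) 0 + x) ∂ε| ≤ C := abs_integral_le_of_bounded fun x => hC _
  rw [abs_le] at *
  unfold stepOp
  constructor <;> nlinarith

theorem measurable_iterate_stepOp {f : ℝ → ℝ} (hf : Measurable f) (n : ℕ) :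
    Measurable ((stepOp q M ε)^[n] f) := by
  induction n with
  | zero => exact hf
  | succ n ih => rw [Function.iterate_succ_apply']; exact measurable_stepOp ih

theorem abs_iterate_stepOp_le (hq0 : 0 ≤ q) (hq1 : q ≤ 1) {f : ℝ → ℝ} {C : ℝ}
    (hC : ∀ x, |f x| ≤ C) (n : ℕ) (b : ℝ) : |(stepOp q M ε)^[n] f b| ≤ C := by
  induction n generalizing b with
  | zero => exact hC b
  | succ n ih => rw [Function.iterate_succ_apply']; exact abs_stepOp_le hq0 hq1 ih b

theorem isProbabilityMeasure_stepLaw (hq0 : 0 ≤ q) (hq1 : q ≤ 1) {ν : Measure ℝ}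
    [IsProbabilityMeasure ν] : IsProbabilityMeasure (stepLaw q M ε ν) := by
  have : IsProbabilityMeasure (ν.map fun b => max (b - M) 0) :=
    Measure.isProbabilityMeasure_map (by fun_prop)
  constructor
  simp only [stepLaw, Measure.add_apply, Measure.smul_apply, measure_univ, ENNReal.smul_def,
    smul_eq_mul, mul_one]
  rw [← ENNReal.coe_add, ← Real.toNNReal_add (by linarith) hq0]
  simp

/-- Duality between `stepLaw` and `stepOp`: convergence of laws reduces to pointwise estimates of
`stepOp` iterates in the starting energy. -/
theorem integral_stepLaw (hq0 : 0 ≤ q) (hq1 : q ≤ 1) {ν : Measure ℝ} [IsProbabilityMeasure ν]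
    {f : ℝ → ℝ} (hf : Measurable f) {C : ℝ} (hC : ∀ x, |f x| ≤ C) :
    ∫ x, f x ∂(stepLaw q M ε ν) = ∫ b, stepOp q M ε f b ∂ν := by
  have : IsProbabilityMeasure (ν.map fun b => max (b - M) 0) :=
    Measure.isProbabilityMeasure_map (by fun_prop)
  have h1 : Measurable fun b => ∫ x, f (b + x) ∂ε :=
    (StronglyMeasurable.integral_prod_right (f := fun b x => f (b + x))
      (by apply Measurable.stronglyMeasurable; fun_prop)).measurable
  have h2 : Measurable fun b => ∫ x, f (max (b - M) 0 + x) ∂ε := h1.comp (by fun_prop)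
  have hb (b : ℝ) : |∫ x, f (b + x) ∂ε| ≤ C := abs_integral_le_of_bounded fun x => hC _
  unfold stepLaw stepOp
  rw [integral_add_measure ((integrable_of_bounded hf hC).smul_measure_nnreal)
      ((integrable_of_bounded hf hC).smul_measure_nnreal),
    integral_smul_nnreal_measure, integral_smul_nnreal_measure,
    integral_conv (integrable_of_bounded hf hC), integral_conv (integrable_of_bounded hf hC),
    integral_map (by fun_prop) h1.aestronglyMeasurable,
    integral_add ((integrable_of_bounded h1 hb).const_mul _)
      ((integrable_of_bounded h2 fun b => hb _).const_mul _),
    integral_const_mul, integral_const_mul]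
  simp [NNReal.smul_def, hq0, hq1]

theorem isProbabilityMeasure_iterate_stepLaw (hq0 : 0 ≤ q) (hq1 : q ≤ 1) {ν : Measure ℝ}
    [IsProbabilityMeasure ν] (n : ℕ) : IsProbabilityMeasure ((stepLaw q M ε)^[n] ν) := by
  induction n with
  | zero => assumption
  | succ n ih =>
    rw [Function.iterate_succ_apply']
    exact isProbabilityMeasure_stepLaw hq0 hq1

theorem integral_iterate_stepLaw (hq0 : 0 ≤ q) (hq1 : q ≤ 1) {ν : Measure ℝ}
    [IsProbabilityMeasure ν] {f : ℝ → ℝ} (hf : Measurable f) {C : ℝ} (hC : ∀ x, |f x| ≤ C)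
    (n : ℕ) : ∫ x, f x ∂((stepLaw q M ε)^[n] ν) = ∫ b, (stepOp q M ε)^[n] f b ∂ν := by
  induction n generalizing f with
  | zero => rfl
  | succ n ih =>
    have := isProbabilityMeasure_iterate_stepLaw (M := M) (ε := ε) (ν := ν) hq0 hq1 n
    rw [Function.iterate_succ_apply', integral_stepLaw hq0 hq1 hf hC,
      ih (measurable_stepOp hf) (abs_stepOp_le hq0 hq1 hC), Function.iterate_succ_apply]

/-- For fixed inputs both moves of the buffer are monotone in its content, so the chain is
stochastically monotone. -/
theorem antitone_stepOp (hq0 : 0 ≤ q) (hq1 : q ≤ 1) {f : ℝ → ℝ} (hf : Antitone f) {C : ℝ}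
    (hC : ∀ x, |f x| ≤ C) : Antitone (stepOp q M ε f) := by
  intro b c hbc
  have hm := hf.measurable
  have h (u v : ℝ) (huv : u ≤ v) : ∫ x, f (v + x) ∂ε ≤ ∫ x, f (u + x) ∂ε :=
    integral_mono (integrable_of_bounded (by fun_prop) fun x => hC _)
      (integrable_of_bounded (by fun_prop) fun x => hC _) fun x => hf (by gcongr)
  unfold stepOp
  have h1 : 0 ≤ 1 - q := by linarith
  have h2 := h b c hbc
  have h3 := h (max (b - M) 0) (max (c - M) 0) (by gcongr)
  gcongr

theorem antitone_iterate_stepOp (hq0 : 0 ≤ q) (hq1 : q ≤ 1) {f : ℝ → ℝ} (hf : Antitone f) {C : ℝ}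
    (hC : ∀ x, |f x| ≤ C) (n : ℕ) : Antitone ((stepOp q M ε)^[n] f) := by
  induction n with
  | zero => exact hf
  | succ n ih =>
    rw [Function.iterate_succ_apply']
    exact antitone_stepOp hq0 hq1 ih (abs_iterate_stepOp_le hq0 hq1 hC n)

/-- Started from the empty buffer, expectations of antitone functions decrease in time. -/
theorem iterate_succ_stepOp_zero_le (hq0 : 0 ≤ q) (hq1 : q ≤ 1) (hε : ∀ᵐ x ∂ε, 0 < x)
    {f : ℝ → ℝ} (hf : Antitone f) {C : ℝ} (hC : ∀ x, |f x| ≤ C) (n : ℕ) :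
    (stepOp q M ε)^[n + 1] f 0 ≤ (stepOp q M ε)^[n] f 0 := by
  rw [Function.iterate_succ_apply']
  -- The first step is split off and `g` accounts for the other `n`. From the empty buffer either
  -- move ends above `0`, and `g` is antitone.
  set g := (stepOp q M ε)^[n] f with hg
  have hga : Antitone g := antitone_iterate_stepOp hq0 hq1 hf hC n
  have hgC : ∀ x, |g x| ≤ C := abs_iterate_stepOp_le hq0 hq1 hC n
  have hm := hga.measurable
  have h (u : ℝ) (hu : 0 ≤ u) : ∫ x, g (u + x) ∂ε ≤ g 0 := by
    calc ∫ x, g (u + x) ∂ε ≤ ∫ x, g 0 ∂ε := by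
          refine integral_mono_ae (integrable_of_bounded (by fun_prop) fun x => hgC _)
            (integrable_const _) ?_
          filter_upwards [hε] with x hx using hga (by positivity)
      _ = g 0 := by simp
  unfold stepOp
  have h1 := h 0 le_rfl
  have h2 := h (max (0 - M) 0) (le_max_right _ _)
  nlinarith

theorem ae_nonneg_stepLaw (hq0 : 0 ≤ q) (hq1 : q ≤ 1) (hε : ∀ᵐ x ∂ε, 0 < x) {ν : Measure ℝ}
    [IsProbabilityMeasure ν] (hν : ∀ᵐ x ∂ν, 0 ≤ x) : ∀ᵐ x ∂(stepLaw q M ε ν), 0 ≤ x := by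
  have := isProbabilityMeasure_stepLaw (M := M) (ε := ε) (ν := ν) hq0 hq1
  have hC : ∀ x : ℝ, |(Set.Iio (0 : ℝ)).indicator (fun _ => (1 : ℝ)) x| ≤ 1 := fun x => by
    simp only [Set.indicator_apply]; split_ifs <;> simp
  have h := integral_stepLaw (M := M) (ε := ε) (ν := ν) hq0 hq1
    (f := (Set.Iio (0 : ℝ)).indicator fun _ => 1) (by measurability) hC
  have h0 : ∫ b, stepOp q M ε ((Set.Iio (0 : ℝ)).indicator fun _ => 1) b ∂ν = 0 := by
    refine integral_eq_zero_of_ae ?_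
    filter_upwards [hν] with b hb
    have h1 (u : ℝ) (hu : 0 ≤ u) :
        ∫ x, (Set.Iio (0 : ℝ)).indicator (fun _ => (1 : ℝ)) (u + x) ∂ε = 0 := by
      refine integral_eq_zero_of_ae ?_
      filter_upwards [hε] with x hx
      have : 0 ≤ u + x := by positivity
      simp [this]
    simp [stepOp, h1 b hb, h1 _ (le_max_right _ _)]
  rw [h0, integral_indicator measurableSet_Iio] at h
  simp only [integral_const, smul_eq_mul, mul_one, measureReal_restrict_apply_univ] at h
  rw [ae_iff]
  simpa [Set.Iio, measureReal_eq_zero_iff] using h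

theorem ae_nonneg_iterate_stepLaw (hq0 : 0 ≤ q) (hq1 : q ≤ 1) (hε : ∀ᵐ x ∂ε, 0 < x)
    {ν : Measure ℝ} [IsProbabilityMeasure ν] (hν : ∀ᵐ x ∂ν, 0 ≤ x) (n : ℕ) :
    ∀ᵐ x ∂((stepLaw q M ε)^[n] ν), 0 ≤ x := by
  induction n with
  | zero => exact hν
  | succ n ih =>
    have := isProbabilityMeasure_iterate_stepLaw (M := M) (ε := ε) (ν := ν) hq0 hq1 n
    rw [Function.iterate_succ_apply']
    exact ae_nonneg_stepLaw hq0 hq1 hε ih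

end Step

/-! ### Positive recurrence -/

section Recurrent

theorem integrable_exp_mul_expMeasure {r s : ℝ} (hr : 0 < r) (hs : s < r) :
    Integrable (fun x => Real.exp (s * x)) (expMeasure r) := by
  have h1 : expMeasure r = volume.withDensity
      (fun x => ENNReal.ofReal (exponentialPDFReal r x)) := rfl
  rw [h1, integrable_withDensity_iff (by fun_prop)
    (Eventually.of_forall fun _ => ENNReal.ofReal_lt_top)]
  have h2 : IntegrableOn (fun x => r * Real.exp ((s - r) * x)) (Set.Ici 0) :=
    ((integrableOn_Ici_iff_integrableOn_Ioi).mpr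
      (integrableOn_exp_mul_Ioi (by linarith) 0)).const_mul r
  refine ((integrable_indicator_iff measurableSet_Ici).mpr h2).congr
    (Eventually.of_forall fun x => ?_)
  beta_reduce
  rw [ENNReal.toReal_ofReal (exponentialPDFReal_nonneg hr x)]
  simp only [exponentialPDFReal, gammaPDFReal, Set.indicator_apply, Set.mem_Ici]
  split_ifs
  · have : (s - r) * x = s * x + -(r * x) := by ring
    rw [this, Real.exp_add]
    simp
    ring
  · simp

theorem integral_exp_mul_expMeasure {r s : ℝ} (hr : 0 < r) (hs : s < r) :
    ∫ x, Real.exp (s * x) ∂(expMeasure r) = r / (r - s) := by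
  rw [integral_expMeasure hr]
  have h (x : ℝ) : (r * Real.exp (-(r * x))) • Real.exp (s * x)
      = r * Real.exp ((s - r) * x) := by
    rw [smul_eq_mul, mul_assoc, ← Real.exp_add]
    ring_nf
  simp_rw [h]
  rw [integral_const_mul, integral_exp_mul_Ioi (by linarith)]
  have h2 : r - s ≠ 0 := by linarith
  have h3 : s - r ≠ 0 := by linarith
  simp only [mul_zero, Real.exp_zero]
  field_simp
  ring

variable {q M r : ℝ}

/-- Two copies of the buffer driven by the same inputs merge when the fuller one is reset, which
happens at a geometric rate if `E[exp (s (X - D))] < 1` for the harvested energy `X` and the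
energy `D` drawn from the buffer. -/
theorem abs_iterate_stepOp_sub_le (hq0 : 0 ≤ q) (hq1 : q ≤ 1) (hr : 0 < r) {s : ℝ}
    (hs0 : 0 < s) (hs : s < r) {f : ℝ → ℝ} (hf : Measurable f) {C : ℝ} (hC : ∀ x, |f x| ≤ C)
    (n : ℕ) {b c : ℝ} (hb : 0 ≤ b) (hbc : b ≤ c) :
    |(stepOp q M (expMeasure r))^[n] f b - (stepOp q M (expMeasure r))^[n] f c|
      ≤ 2 * C * (r / (r - s) * (1 - q + q * Real.exp (-(s * M)))) ^ n * Real.exp (s * c) := by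
  have := isProbabilityMeasure_expMeasure hr
  have hC0 : 0 ≤ C := (abs_nonneg _).trans (hC 0)
  have hrs : 0 < r - s := by linarith
  have h1q : 0 ≤ 1 - q := by linarith
  induction n generalizing b c with
  | zero =>
    have h1 := hC b
    have h2 := hC c
    have h3 : 1 ≤ Real.exp (s * c) := Real.one_le_exp (by have := hb.trans hbc; positivity)
    have h4 := abs_sub (f b) (f c)
    simp only [Function.iterate_zero, id_eq, pow_zero, mul_one]
    nlinarith
  | succ n ih =>
    rw [Function.iterate_succ_apply']
    set g := (stepOp q M (expMeasure r))^[n] f with hg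
    set K := 2 * C * (r / (r - s) * (1 - q + q * Real.exp (-(s * M)))) ^ n with hK
    have hK0 : 0 ≤ K := by positivity
    have hgm : Measurable g := measurable_iterate_stepOp hf n
    have hgC : ∀ x, |g x| ≤ C := abs_iterate_stepOp_le hq0 hq1 hC n
    -- A common harvested amount costs the factor `r / (r - s) = E[exp (s X)]`.
    have key (u v : ℝ) (hu : 0 ≤ u) (huv : u ≤ v) :
        |∫ x, g (u + x) ∂(expMeasure r) - ∫ x, g (v + x) ∂(expMeasure r)|
          ≤ K * Real.exp (s * v) * (r / (r - s)) := by
      rw [← integral_sub (integrable_of_bounded (by fun_prop) fun x => hgC _)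
        (integrable_of_bounded (by fun_prop) fun x => hgC _),
        ← integral_exp_mul_expMeasure hr hs, ← integral_const_mul, ← Real.norm_eq_abs]
      refine MeasureTheory.norm_integral_le_of_norm_le
        ((integrable_exp_mul_expMeasure hr hs).const_mul _) ?_
      filter_upwards [expMeasure_ae_pos r] with x hx
      rw [mul_assoc, ← Real.exp_add, ← mul_add]
      exact ih (by positivity) (by linarith)
    have e1 := key b c hb hbc
    have e2 : |∫ x, g (max (b - M) 0 + x) ∂(expMeasure r)
        - ∫ x, g (max (c - M) 0 + x) ∂(expMeasure r)|
          ≤ K * Real.exp (s * (c - M)) * (r / (r - s)) := by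
      -- If `c ≤ M`, both copies are emptied and coincide from then on; otherwise the fuller one
      -- loses exactly `M`, which gains the factor `exp (-s M)`.
      rcases le_total c M with h | h
      · rw [max_eq_right (by linarith), max_eq_right (by linarith), sub_self, abs_zero]
        positivity
      · have h2 := key (max (b - M) 0) (max (c - M) 0) (le_max_right _ _) (by gcongr)
        rwa [max_eq_left (sub_nonneg.mpr h)] at h2 ⊢
    have e3 : Real.exp (s * (c - M)) = Real.exp (s * c) * Real.exp (-(s * M)) := by
      rw [← Real.exp_add]; ring_nf
    rw [e3] at e2
    unfold stepOp
    calc _ = |(1 - q) * (∫ x, g (b + x) ∂(expMeasure r) - ∫ x, g (c + x) ∂(expMeasure r))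
          + q * (∫ x, g (max (b - M) 0 + x) ∂(expMeasure r)
        - ∫ x, g (max (c - M) 0 + x) ∂(expMeasure r))| := by ring_nf
      _ ≤ (1 - q) * (K * Real.exp (s * c) * (r / (r - s)))
          + q * (K * (Real.exp (s * c) * Real.exp (-(s * M))) * (r / (r - s))) := by
        refine (abs_add_le _ _).trans ?_
        rw [abs_mul, abs_mul, abs_of_nonneg hq0, abs_of_nonneg h1q]
        gcongr
      _ = _ := by rw [hK]; ring

/-- If on average more energy is drawn than harvested, then the influence of the initial energy
vanishes. -/
theorem tendsto_iterate_stepOp_sub (hq0 : 0 ≤ q) (hq1 : q ≤ 1) (hM : 0 < M) (hr : 0 < r)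
    (hphi : 1 < M * r * q) {f : ℝ → ℝ} (hf : Measurable f) {C : ℝ} (hC : ∀ x, |f x| ≤ C)
    {b c : ℝ} (hb : 0 ≤ b) (hc : 0 ≤ c) :
    Tendsto (fun n => (stepOp q M (expMeasure r))^[n] f b
      - (stepOp q M (expMeasure r))^[n] f c) atTop (𝓝 0) := by
  obtain ⟨s, hs0, hs, hρ0, hρ⟩ : ∃ s, 0 < s ∧ s < r ∧
      0 ≤ r / (r - s) * (1 - q + q * Real.exp (-(s * M))) ∧
      r / (r - s) * (1 - q + q * Real.exp (-(s * M))) < 1 := by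
    -- The contraction factor is below `1` iff `s < r q (1 - exp (-s M))`. As `1 - exp (-y) ≥ y / (1
    -- + y)`, this follows from `1 + s M < M r q`; the chosen `s` puts `1 + s M` midway between `1`
    -- and `M r q`.
    set s := (M * r * q - 1) / (2 * M) with hs
    have hs0 : 0 < s := div_pos (by linarith) (by linarith)
    have hsM : 1 + s * M < M * r * q := by
      rw [hs]; field_simp; linarith
    have hexp : Real.exp (-(s * M)) * (1 + s * M) ≤ 1 := by
      have h1 := Real.add_one_le_exp (s * M)
      have h2 : Real.exp (-(s * M)) * Real.exp (s * M) = 1 := by rw [← Real.exp_add]; simp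
      nlinarith [Real.exp_pos (-(s * M))]
    have hpos : 0 < 1 + s * M := by positivity
    have hlt : s < r * q * (1 - Real.exp (-(s * M))) := by
      have h1 : s * M ≤ (1 - Real.exp (-(s * M))) * (1 + s * M) := by linarith
      have h2 : s * M * (M * r * q) ≤ (1 - Real.exp (-(s * M))) * (1 + s * M) * (M * r * q) := by
        gcongr
      have h3 : s * M * (1 + s * M) < s * M * (M * r * q) := by gcongr
      have h4 : (M * (1 + s * M)) * s
          < (M * (1 + s * M)) * (r * q * (1 - Real.exp (-(s * M)))) := by linarith
      exact lt_of_mul_lt_mul_left h4 (by positivity)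
    have hsr : s < r := by
      have h1 : r * q * (1 - Real.exp (-(s * M))) ≤ r * 1 * 1 := by
        have := Real.exp_pos (-(s * M))
        gcongr
        · have : Real.exp (-(s * M)) ≤ 1 := Real.exp_le_one_iff.mpr (by nlinarith)
          linarith
        · linarith
      linarith
    have hrs : 0 < r - s := by linarith
    have h1q : 0 ≤ 1 - q := by linarith
    refine ⟨s, hs0, hsr, by positivity, ?_⟩
    rw [div_mul_eq_mul_div, div_lt_one hrs]
    linarith
  have hlim : Tendsto (fun n => 2 * C * (r / (r - s) * (1 - q + q * Real.exp (-(s * M)))) ^ n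
      * Real.exp (s * max b c)) atTop (𝓝 0) := by
    simpa using ((tendsto_pow_atTop_nhds_zero_of_lt_one hρ0 hρ).const_mul (2 * C)).mul_const
      (Real.exp (s * max b c))
  refine squeeze_zero_norm (fun n => ?_) hlim
  rcases le_total b c with h | h
  · rw [max_eq_right h]
    exact abs_iterate_stepOp_sub_le hq0 hq1 hr hs0 hs hf hC n hb h
  · rw [max_eq_left h, norm_sub_rev]
    exact abs_iterate_stepOp_sub_le hq0 hq1 hr hs0 hs hf hC n hc h

-- Memorylessness: the excess over `M` is `0` with probability `1 - exp (-z M)`, and otherwise has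
-- the law `Exp(z)` again.
open Complex in
theorem charFun_expMeasure_map_max_sub {z : ℝ} (hz : 0 < z) (hM : 0 < M) (t : ℝ) :
    charFun ((expMeasure z).map fun b => max (b - M) 0) t
      = 1 - Real.exp (-(z * M)) + Real.exp (-(z * M)) * (z / (z - t * I)) := by
  rw [charFun_apply_real, integral_map (by fun_prop) (by fun_prop), integral_expMeasure hz]
  have h (x : ℝ) : (z * Real.exp (-(z * x))) • cexp (t * (max (x - M) 0 : ℝ) * I)
      = z * cexp (-z * x) + (Set.Ioi M).indicator
        (fun x : ℝ => z * cexp (-(t * M * I)) * cexp ((t * I - z) * x) - z * cexp (-z * x)) x := by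
    rw [Complex.real_smul]
    push_cast
    simp only [Set.indicator_apply, Set.mem_Ioi]
    split_ifs with hx
    · rw [max_eq_left (by linarith)]
      push_cast
      rw [mul_assoc (z : ℂ), mul_assoc (z : ℂ), ← Complex.exp_add, ← Complex.exp_add]
      ring_nf
    · rw [max_eq_right (by linarith)]
      simp
  simp_rw [h]
  have hz1 : (-(z : ℂ)).re < 0 := by simpa using hz
  have hz2 : ((t : ℂ) * I - z).re < 0 := by simpa using hz
  have i1 (c : ℝ) : IntegrableOn (fun x : ℝ => (z : ℂ) * cexp (-z * x)) (Set.Ioi c) :=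
    (integrableOn_exp_mul_complex_Ioi hz1 c).const_mul _
  have i2 (c : ℝ) : IntegrableOn
      (fun x : ℝ => (z : ℂ) * cexp (-(t * M * I)) * cexp ((t * I - z) * x)) (Set.Ioi c) :=
    (integrableOn_exp_mul_complex_Ioi hz2 c).const_mul _
  have i3 : IntegrableOn (fun x : ℝ => (z : ℂ) * cexp (-(t * M * I)) * cexp ((t * I - z) * x)
      - z * cexp (-z * x)) (Set.Ioi 0) := (i2 0).sub (i1 0)
  rw [integral_add (i1 0) (i3.indicator measurableSet_Ioi),
    setIntegral_indicator measurableSet_Ioi,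
    Set.inter_eq_self_of_subset_right (Set.Ioi_subset_Ioi hM.le),
    integral_sub (i2 M) (i1 M), integral_const_mul, integral_const_mul, integral_const_mul,
    integral_exp_mul_complex_Ioi hz1, integral_exp_mul_complex_Ioi hz1,
    integral_exp_mul_complex_Ioi hz2]
  have h2 : (z : ℂ) - t * I ≠ 0 := fun h => hz.ne' (by simpa using congrArg Complex.re h)
  have h3 : (t : ℂ) * I - z ≠ 0 := fun h => h2 (by linear_combination -h)
  have h4 : (z : ℂ) ≠ 0 := ofReal_ne_zero.mpr hz.ne'
  have h5 : cexp ((t * I - z) * M) = cexp (t * M * I) * cexp (-z * M) := by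
    rw [← Complex.exp_add]; ring_nf
  have h6 : cexp (-(t * M * I)) * cexp (t * M * I) = 1 := by rw [← Complex.exp_add]; simp
  have h7 : ((Real.exp (-(z * M)) : ℝ) : ℂ) = cexp (-z * M) := by push_cast; ring_nf
  rw [h5, h7]
  have h8 : (z : ℂ) / (t * I - z) = - (z / (z - t * I)) := by
    field_simp; ring
  have e1 : (z : ℂ) * (-cexp (-z * (0 : ℝ)) / -z) = 1 := by simp [h4]
  have e2 : (z : ℂ) * (-cexp (-z * M) / -z) = cexp (-z * M) := by field_simp
  have e3 : (z : ℂ) * cexp (-(t * M * I)) * (-(cexp (t * M * I) * cexp (-z * M)) / (t * I - z))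
      = cexp (-z * M) * (z / (z - t * I)) := by
    calc _ = -(cexp (-(t * M * I)) * cexp (t * M * I)) * cexp (-z * M) * (z / (t * I - z)) := by
          ring
      _ = _ := by rw [h6, h8]; ring
  rw [e1, e2, e3]
  ring

open Complex in
/-- The exponential law whose rate solves the Lundberg equation is stationary. -/
theorem stepLaw_expMeasure (hq0 : 0 ≤ q) (hq1 : q ≤ 1) (hM : 0 < M) (hr : 0 < r) {z : ℝ}
    (hz : 0 < z) (hzr : z = r * q * (1 - Real.exp (-(z * M)))) :
    stepLaw q M (expMeasure r) (expMeasure z) = expMeasure z := by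
  have := isProbabilityMeasure_expMeasure hr
  have := isProbabilityMeasure_expMeasure hz
  have : IsProbabilityMeasure ((expMeasure z).map fun b => max (b - M) 0) :=
    Measure.isProbabilityMeasure_map (by fun_prop)
  have := isProbabilityMeasure_stepLaw (M := M) (ε := expMeasure r) (ν := expMeasure z) hq0 hq1
  refine Measure.ext_of_charFun (funext fun t => ?_)
  have hi (μ : Measure ℝ) [IsFiniteMeasure μ] : Integrable (fun x : ℝ => cexp (t * x * I)) μ := by
    refine Integrable.of_bound (by fun_prop) 1 (Eventually.of_forall fun x => ?_)
    rw [← ofReal_mul, Complex.norm_exp_ofReal_mul_I]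
  have h1 : charFun (stepLaw q M (expMeasure r) (expMeasure z)) t
      = (1 - q) * (charFun (expMeasure z) t * charFun (expMeasure r) t)
        + q * (charFun ((expMeasure z).map fun b => max (b - M) 0) t
          * charFun (expMeasure r) t) := by
    rw [← charFun_conv, ← charFun_conv, charFun_apply_real, charFun_apply_real, charFun_apply_real,
      stepLaw, integral_add_measure (hi _).smul_measure_nnreal (hi _).smul_measure_nnreal,
      integral_smul_nnreal_measure, integral_smul_nnreal_measure]
    simp [NNReal.smul_def, hq0, hq1]
  rw [h1, charFun_expMeasure_map_max_sub hz hM, charFun_expMeasure hz, charFun_expMeasure hr]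
  have h2 : (z : ℂ) - t * I ≠ 0 := fun h => hz.ne' (by simpa using congrArg Complex.re h)
  have h3 : (r : ℂ) - t * I ≠ 0 := fun h => hr.ne' (by simpa using congrArg Complex.re h)
  have h4 : (z : ℂ) = r * q * (1 - (Real.exp (-(z * M)) : ℝ)) := by
    exact_mod_cast congrArg ((↑) : ℝ → ℂ) hzr
  generalize ((Real.exp (-(z * M)) : ℝ) : ℂ) = e at *
  rw [← sub_eq_zero]
  -- The difference of the transforms carries the factor `r q (1 - e) - z`, which the Lundberg
  -- equation annihilates.
  have : ((1 - (q : ℂ)) * (z / (z - t * I) * (r / (r - t * I)))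
      + q * ((1 - e + e * (z / (z - t * I))) * (r / (r - t * I)))) - z / (z - t * I)
      = ((r * q * (1 - e)) - z) * (-t * I) / ((z - t * I) * (r - t * I)) := by
    field_simp
    ring
  rw [this, ← h4]
  simp

/-- If on average more energy is drawn than harvested, then the law of the stored energy converges
to the exponential law whose rate solves the Lundberg equation. -/
theorem tendsto_integral_iterate_stepLaw (hq0 : 0 ≤ q) (hq1 : q ≤ 1) (hM : 0 < M) (hr : 0 < r)
    (hphi : 1 < M * r * q) {z : ℝ} (hz : 0 < z)
    (hzr : z = r * q * (1 - Real.exp (-(z * M)))) {f : ℝ → ℝ} (hf : Measurable f) {C : ℝ}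
    (hC : ∀ x, |f x| ≤ C) {ν : Measure ℝ} [IsProbabilityMeasure ν] (hν : ∀ᵐ x ∂ν, 0 ≤ x) :
    Tendsto (fun n => ∫ x, f x ∂((stepLaw q M (expMeasure r))^[n] ν)) atTop
      (𝓝 (∫ x, f x ∂(expMeasure z))) := by
  have := isProbabilityMeasure_expMeasure hr
  have := isProbabilityMeasure_expMeasure hz
  have hfix (n : ℕ) : (stepLaw q M (expMeasure r))^[n] (expMeasure z) = expMeasure z :=
    Function.iterate_fixed (stepLaw_expMeasure hq0 hq1 hM hr hz hzr) n
  have hT (n : ℕ) := measurable_iterate_stepOp (q := q) (M := M) (ε := expMeasure r) hf n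
  have hTC (n : ℕ) := abs_iterate_stepOp_le (q := q) (M := M) (ε := expMeasure r) hq0 hq1 hC n
  -- Stationarity allows both terms to be written with `n` steps, from independent starting points
  -- of laws `ν` and `Exp(z)`; dominated convergence then applies to the pointwise merging.
  have hsub (n : ℕ) : ∫ x, f x ∂((stepLaw q M (expMeasure r))^[n] ν) - ∫ x, f x ∂(expMeasure z)
      = ∫ y, ((stepOp q M (expMeasure r))^[n] f y.1 - (stepOp q M (expMeasure r))^[n] f y.2)
        ∂(ν.prod (expMeasure z)) := by
    have i1 : Integrable (fun y : ℝ × ℝ => (stepOp q M (expMeasure r))^[n] f y.1)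
        (ν.prod (expMeasure z)) :=
      integrable_of_bounded ((hT n).comp measurable_fst) fun y => hTC n _
    have i2 : Integrable (fun y : ℝ × ℝ => (stepOp q M (expMeasure r))^[n] f y.2)
        (ν.prod (expMeasure z)) :=
      integrable_of_bounded ((hT n).comp measurable_snd) fun y => hTC n _
    rw [integral_sub i1 i2, integral_fun_fst, integral_fun_snd,
      ← integral_iterate_stepLaw (ν := ν) hq0 hq1 hf hC,
      ← integral_iterate_stepLaw (ν := expMeasure z) hq0 hq1 hf hC, hfix n]
    simp
  rw [tendsto_iff_norm_sub_tendsto_zero]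
  simp_rw [hsub]
  have h0 : Tendsto (fun n => ∫ y, ((stepOp q M (expMeasure r))^[n] f y.1
      - (stepOp q M (expMeasure r))^[n] f y.2) ∂(ν.prod (expMeasure z))) atTop
      (𝓝 (∫ _, 0 ∂(ν.prod (expMeasure z)))) := by
    refine tendsto_integral_of_dominated_convergence (fun _ => C + C) (fun n => ?_)
      (integrable_const _) (fun n => Eventually.of_forall fun y => ?_) ?_
    · exact (((hT n).comp measurable_fst).sub ((hT n).comp measurable_snd)).aestronglyMeasurable
    · exact (norm_sub_le _ _).trans (add_le_add (hTC n _) (hTC n _))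
    · have a1 : ∀ᵐ y ∂(ν.prod (expMeasure z)), 0 ≤ y.1 :=
        Measure.quasiMeasurePreserving_fst.ae hν
      have a2 : ∀ᵐ y ∂(ν.prod (expMeasure z)), 0 < y.2 :=
        Measure.quasiMeasurePreserving_snd.ae (expMeasure_ae_pos z)
      filter_upwards [a1, a2] with y h1 h2
      exact tendsto_iterate_stepOp_sub hq0 hq1 hM hr hphi hf hC h1 h2.le
  simpa using h0.norm

end Recurrent

/-! ### The absence of a stationary law -/

section Transient

variable {q M r : ℝ}

/-- The truncation `max b 0` changes nothing where the chain lives, and makes the test functions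
bounded and antitone on the whole line. -/
theorem abs_exp_neg_mul_max_le_one {θ : ℝ} (hθ : 0 ≤ θ) (b : ℝ) :
    |Real.exp (-(θ * max b 0))| ≤ 1 := by
  rw [abs_of_pos (Real.exp_pos _), Real.exp_le_one_iff]
  have : 0 ≤ θ * max b 0 := mul_nonneg hθ (le_max_right _ _)
  linarith

theorem abs_deficit_le (hM : 0 < M) (b : ℝ) : |max (M - max b 0) 0| ≤ M := by
  rw [abs_of_nonneg (le_max_right _ _)]
  exact max_le (by linarith [le_max_right b 0]) hM.le

/-- Without the floor at `0`, a draw would multiply `exp (-θ b)` by `exp (θ M)`. For `b < M` the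
floor saves `exp (θ (M - b)) - 1 ≥ θ (M - b)`, which is the deficit term. -/
theorem stepOp_exp_le (hq0 : 0 ≤ q) (hr : 0 < r) {θ : ℝ} (hθ : 0 < θ) {b : ℝ} (hb : 0 ≤ b) :
    stepOp q M (expMeasure r) (fun b => Real.exp (-(θ * max b 0))) b
      ≤ r / (r + θ) * ((1 - q + q * Real.exp (θ * M)) * Real.exp (-(θ * max b 0))
        - q * θ * max (M - max b 0) 0) := by
  have h1 (u : ℝ) (hu : 0 ≤ u) : ∫ x, Real.exp (-(θ * max (u + x) 0)) ∂(expMeasure r)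
      = Real.exp (-(θ * u)) * (r / (r + θ)) := by
    have h := integral_exp_mul_expMeasure hr (s := -θ) (by linarith)
    rw [sub_neg_eq_add] at h
    rw [← h, ← integral_const_mul]
    refine integral_congr_ae ?_
    filter_upwards [expMeasure_ae_pos r] with x hx
    rw [max_eq_left (by positivity), ← Real.exp_add]
    ring_nf
  have h2 : Real.exp (-(θ * max (b - M) 0))
      ≤ Real.exp (θ * M) * Real.exp (-(θ * b)) - θ * max (M - b) 0 := by
    rw [← Real.exp_add]
    rcases le_total b M with h | h
    · rw [max_eq_right (by linarith), max_eq_left (by linarith)]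
      have := Real.add_one_le_exp (θ * M + -(θ * b))
      simp only [mul_zero, neg_zero, Real.exp_zero]
      linarith
    · rw [max_eq_left (by linarith), max_eq_right (by linarith)]
      ring_nf
      exact le_rfl
  unfold stepOp
  rw [h1 b hb, h1 _ (le_max_right _ _), max_eq_left hb]
  have h3 : 0 ≤ r / (r + θ) := by positivity
  calc _ ≤ (1 - q) * (Real.exp (-(θ * b)) * (r / (r + θ)))
        + q * ((Real.exp (θ * M) * Real.exp (-(θ * b)) - θ * max (M - b) 0) * (r / (r + θ))) := by
        gcongr
    _ = _ := by ring

theorem antitone_exp_neg_mul_max {θ : ℝ} (hθ : 0 ≤ θ) :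
    Antitone fun b : ℝ => Real.exp (-(θ * max b 0)) := fun b c hbc => by
  dsimp only
  gcongr

theorem antitone_deficit : Antitone fun b : ℝ => max (M - max b 0) 0 := fun b c hbc => by
  dsimp only
  gcongr

/-- If on average at least as much energy is harvested as is drawn, then the expected deficit of
the buffer vanishes in the limit. -/
theorem tendsto_iterate_stepOp_deficit_zero (hq0 : 0 < q) (hq1 : q ≤ 1) (hM : 0 < M) (hr : 0 < r)
    (hphi : M * r * q ≤ 1) :
    Tendsto (fun n => (stepOp q M (expMeasure r))^[n] (fun b => max (M - max b 0) 0) 0) atTop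
      (𝓝 0) := by
  have := isProbabilityMeasure_expMeasure hr
  set T := stepOp q M (expMeasure r) with hT
  set h : ℝ → ℝ := fun b => max (M - max b 0) 0 with hh
  have hhm : Measurable h := antitone_deficit.measurable
  have hhC : ∀ b, |h b| ≤ M := abs_deficit_le hM
  have hpos (n : ℕ) : 0 ≤ T^[n] h 0 := by
    have e := integral_iterate_stepLaw (M := M) (ε := expMeasure r) (ν := Measure.dirac 0)
      hq0.le hq1 hhm hhC n
    rw [integral_dirac] at e
    rw [← e]
    exact integral_nonneg fun x => le_max_right _ _
  -- The drift inequality solved for the mean deficit: a telescoping decrement plus a remainder of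
  -- order `θ`.
  have main {θ : ℝ} (hθ : 0 < θ) (n : ℕ) : T^[n] h 0 ≤
      (T^[n] (fun b => Real.exp (-(θ * max b 0))) 0
        - T^[n + 1] (fun b => Real.exp (-(θ * max b 0))) 0) * ((1 + θ / r) / (q * θ))
      + (Real.exp (θ * M) - 1 - θ * M) / θ := by
    set f : ℝ → ℝ := fun b => Real.exp (-(θ * max b 0)) with hf
    have hfm : Measurable f := (antitone_exp_neg_mul_max hθ.le).measurable
    have hfC : ∀ b, |f b| ≤ 1 := abs_exp_neg_mul_max_le_one hθ.le
    set κ := (stepLaw q M (expMeasure r))^[n] (Measure.dirac 0) with hκ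
    have hκp : IsProbabilityMeasure κ := isProbabilityMeasure_iterate_stepLaw hq0.le hq1 n
    have hκ0 : ∀ᵐ x ∂κ, 0 ≤ x := ae_nonneg_iterate_stepLaw hq0.le hq1 (expMeasure_ae_pos r)
      (by rw [ae_dirac_eq]; exact le_refl (0 : ℝ)) n
    have hint {g : ℝ → ℝ} (hg : Measurable g) {C : ℝ} (hC : ∀ x, |g x| ≤ C) :
        T^[n] g 0 = ∫ x, g x ∂κ := by
      rw [hκ, integral_iterate_stepLaw hq0.le hq1 hg hC, integral_dirac]
    have hstep : T^[n + 1] f 0 ≤ r / (r + θ) * ((1 - q + q * Real.exp (θ * M)) * T^[n] f 0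
        - q * θ * T^[n] h 0) := by
      rw [Function.iterate_succ_apply, hint (measurable_stepOp hfm) (abs_stepOp_le hq0.le hq1 hfC),
        hint hfm hfC, hint hhm hhC, ← integral_const_mul, ← integral_const_mul,
        ← integral_sub ((integrable_of_bounded hfm hfC).const_mul _)
          ((integrable_of_bounded hhm hhC).const_mul _), ← integral_const_mul]
      refine integral_mono_ae (integrable_of_bounded (measurable_stepOp hfm)
        (abs_stepOp_le hq0.le hq1 hfC)) ((((integrable_of_bounded hfm hfC).const_mul _).sub
          ((integrable_of_bounded hhm hhC).const_mul _)).const_mul _) ?_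
      filter_upwards [hκ0] with b hb
      exact stepOp_exp_le hq0.le hr hθ hb
    have ha1 : T^[n] f 0 ≤ 1 :=
      (le_abs_self _).trans (abs_iterate_stepOp_le hq0.le hq1 hfC n 0)
    set a := T^[n] f 0
    set a' := T^[n + 1] f 0
    set c := T^[n] h 0
    have ha0 : 0 ≤ a := by
      rw [show a = _ from hint hfm hfC]
      exact integral_nonneg fun x => (Real.exp_pos _).le
    have hexp := Real.add_one_le_exp (θ * M)
    have h1 : (1 + θ / r) * a' ≤ (1 - q + q * Real.exp (θ * M)) * a - q * θ * c := by
      have e : (1 + θ / r) * (r / (r + θ)) = 1 := by field_simp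
      calc (1 + θ / r) * a' ≤ (1 + θ / r) * (r / (r + θ) *
            ((1 - q + q * Real.exp (θ * M)) * a - q * θ * c)) := by gcongr
        _ = _ := by rw [← mul_assoc, e, one_mul]
    -- The drift assumption cancels the first-order terms in `θ`.
    have h2 : q * θ * M ≤ θ / r := by
      rw [le_div_iff₀ hr]; nlinarith
    have h3 : q * θ * c ≤ (a - a') * (1 + θ / r) + q * (Real.exp (θ * M) - 1 - θ * M) := by
      have h4 : a * (q * (Real.exp (θ * M) - 1) - θ / r)
          ≤ a * (q * (Real.exp (θ * M) - 1 - θ * M)) := by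
        gcongr; linarith
      have h5 : a * (q * (Real.exp (θ * M) - 1 - θ * M))
          ≤ 1 * (q * (Real.exp (θ * M) - 1 - θ * M)) := by
        have : 0 ≤ Real.exp (θ * M) - 1 - θ * M := by linarith
        gcongr
      linarith
    have h6 : c ≤ ((a - a') * (1 + θ / r) + q * (Real.exp (θ * M) - 1 - θ * M)) / (q * θ) := by
      rw [le_div_iff₀ (by positivity)]
      linarith
    refine h6.trans_eq ?_
    field_simp
  rw [Metric.tendsto_atTop]
  intro δ hδ
  -- `|exp x - 1 - x| ≤ x ^ 2` for `|x| ≤ 1` bounds the remainder by `θ M ^ 2`. This `θ` is fixed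
  -- before the time index goes to infinity.
  obtain ⟨θ, hθ, hθ1, hθδ⟩ : ∃ θ, 0 < θ ∧ θ * M ≤ 1 ∧ θ * M ^ 2 ≤ δ / 2 := by
    refine ⟨min (1 / M) (δ / 2 / M ^ 2), by positivity, ?_, ?_⟩
    · rw [← le_div_iff₀ hM]; exact min_le_left _ _
    · rw [← le_div_iff₀ (by positivity)]; exact min_le_right _ _
  have hrem : (Real.exp (θ * M) - 1 - θ * M) / θ ≤ δ / 2 := by
    have h1 := (le_abs_self _).trans (Real.abs_exp_sub_one_sub_id_le (x := θ * M)
      (by rw [abs_of_pos (by positivity)]; exact hθ1))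
    rw [div_le_iff₀ hθ]
    nlinarith
  set a : ℕ → ℝ := fun n => T^[n] (fun b => Real.exp (-(θ * max b 0))) 0 with ha
  have hanti : Antitone a := antitone_nat_of_succ_le fun n =>
    iterate_succ_stepOp_zero_le hq0.le hq1 (expMeasure_ae_pos r)
      (antitone_exp_neg_mul_max hθ.le) (abs_exp_neg_mul_max_le_one hθ.le) n
  have hbdd : BddBelow (Set.range a) := by
    refine ⟨-1, ?_⟩
    rintro _ ⟨n, rfl⟩
    exact (abs_le.mp (abs_iterate_stepOp_le hq0.le hq1 (abs_exp_neg_mul_max_le_one hθ.le) n 0)).1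
  have hlim := tendsto_atTop_ciInf hanti hbdd
  have hlim' : Tendsto (fun n => (a n - a (n + 1)) * ((1 + θ / r) / (q * θ))) atTop (𝓝 0) := by
    have := (hlim.sub (hlim.comp (tendsto_add_atTop_nat 1))).mul_const ((1 + θ / r) / (q * θ))
    simpa using this
  obtain ⟨N, hN⟩ := eventually_atTop.mp (hlim'.eventually_lt_const (half_pos hδ))
  refine ⟨N, fun n hn => ?_⟩
  rw [Real.dist_0_eq_abs, abs_of_nonneg (hpos n)]
  have h1 := main hθ n
  have h2 := hN n hn
  simp only [ha] at h2
  linarith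

/-- If on average at least as much energy is harvested as is drawn, then the relay can eventually
transmit with full power. -/
theorem tendsto_integral_iterate_stepLaw_of_le_one (hq0 : 0 < q) (hq1 : q ≤ 1) (hM : 0 < M)
    (hr : 0 < r) (hphi : M * r * q ≤ 1) {f : ℝ → ℝ} (hf : Measurable f) {C : ℝ}
    (hC : ∀ x, |f x| ≤ C) (hfM : ∀ b, M ≤ b → f b = f M) (hcont : ContinuousAt f M)
    {ν : Measure ℝ} [IsProbabilityMeasure ν] (hν : ∀ᵐ x ∂ν, 0 ≤ x) :
    Tendsto (fun n => ∫ x, f x ∂((stepLaw q M (expMeasure r))^[n] ν)) atTop (𝓝 (f M)) := by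
  have := isProbabilityMeasure_expMeasure hr
  have hC0 : 0 ≤ C := (abs_nonneg _).trans (hC 0)
  set h : ℝ → ℝ := fun b => max (M - max b 0) 0 with hh
  have hhm : Measurable h := antitone_deficit.measurable
  have hhC : ∀ b, |h b| ≤ M := abs_deficit_le hM
  have hdef := tendsto_iterate_stepOp_deficit_zero hq0 hq1 hM hr hphi
  rw [Metric.tendsto_atTop]
  intro δ hδ
  obtain ⟨η, hη, hηf⟩ := Metric.continuousAt_iff.mp hcont (δ / 2) (half_pos hδ)
  -- Markov's inequality in pointwise form: continuity at `M` handles deficits below `η`, and the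
  -- trivial bound `2 C` the others.
  have hbound (b : ℝ) (hb : 0 ≤ b) : |f b - f M| ≤ δ / 2 + 2 * C / η * h b := by
    have hh0 : 0 ≤ h b := le_max_right _ _
    rcases lt_or_ge (h b) η with hlt | hge
    · have : |f b - f M| ≤ δ / 2 := by
        rcases le_total M b with hMb | hMb
        · rw [hfM b hMb, sub_self, abs_zero]; positivity
        · refine (hηf ?_).le
          rw [Real.dist_eq, abs_sub_comm, abs_of_nonneg (by linarith)]
          simpa [hh, hb, hη] using hlt
      have : 0 ≤ 2 * C / η * h b := by positivity
      linarith
    · have h1 : |f b - f M| ≤ 2 * C := by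
        have := abs_sub (f b) (f M)
        linarith [hC b, hC M]
      have h2 : 2 * C / η * η ≤ 2 * C / η * h b := by gcongr
      rw [div_mul_cancel₀ _ hη.ne'] at h2
      linarith
  have hev := (hdef.const_mul (2 * C / η)).eventually_lt_const
    (show 2 * C / η * 0 < δ / 2 by simpa using hδ)
  obtain ⟨N, hN⟩ := eventually_atTop.mp hev
  refine ⟨N, fun n hn => ?_⟩
  set κ := (stepLaw q M (expMeasure r))^[n] ν with hκ
  have hκp : IsProbabilityMeasure κ := isProbabilityMeasure_iterate_stepLaw hq0.le hq1 n
  have hκ0 : ∀ᵐ x ∂κ, 0 ≤ x :=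
    ae_nonneg_iterate_stepLaw hq0.le hq1 (expMeasure_ae_pos r) hν n
  have e1 : ∫ x, f x ∂κ - f M = ∫ x, (f x - f M) ∂κ := by
    rw [integral_sub (integrable_of_bounded hf hC) (integrable_const _)]
    simp
  -- By monotonicity the empty buffer has the largest expected deficit, so the bound does not depend
  -- on `ν`.
  have e2 : ∫ x, h x ∂κ ≤ (stepOp q M (expMeasure r))^[n] h 0 := by
    rw [hκ, integral_iterate_stepLaw hq0.le hq1 hhm hhC]
    calc _ ≤ ∫ _, (stepOp q M (expMeasure r))^[n] h 0 ∂ν := by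
          refine integral_mono_ae (integrable_of_bounded (measurable_iterate_stepOp hhm n)
            (abs_iterate_stepOp_le hq0.le hq1 hhC n)) (integrable_const _) ?_
          filter_upwards [hν] with b hb
          exact antitone_iterate_stepOp hq0.le hq1 antitone_deficit hhC n hb
      _ = _ := by simp
  rw [Real.dist_eq, e1]
  calc |∫ x, (f x - f M) ∂κ| ≤ ∫ x, (δ / 2 + 2 * C / η * h x) ∂κ := by
        rw [← Real.norm_eq_abs]
        refine MeasureTheory.norm_integral_le_of_norm_le
          ((integrable_const _).add ((integrable_of_bounded hhm hhC).const_mul _)) ?_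
        filter_upwards [hκ0] with b hb using hbound b hb
    _ = δ / 2 + 2 * C / η * ∫ x, h x ∂κ := by
        rw [integral_add (integrable_const _) ((integrable_of_bounded hhm hhC).const_mul _),
          integral_const_mul]
        simp
    _ ≤ δ / 2 + 2 * C / η * (stepOp q M (expMeasure r))^[n] h 0 := by gcongr
    _ < δ := by linarith [hN n hn]

end Transient

/-! ### The parameters of the network -/

section Lambert

theorem lambertW_spec {x : ℝ} (h1 : -Real.exp (-1) ≤ x) (h0 : x ≤ 0) :
    -1 ≤ lambertW x ∧ lambertW x * Real.exp (lambertW x) = x := by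
  have hex : ∃ w ∈ Set.Ici (-1 : ℝ), (fun w : ℝ => w * Real.exp w) w = x := by
    have hiv := intermediate_value_Icc (show (-1 : ℝ) ≤ 0 by norm_num)
      (f := fun w : ℝ => w * Real.exp w) (by fun_prop)
    obtain ⟨w, hw, hwx⟩ := hiv (show x ∈ Set.Icc _ _ by simpa using ⟨h1, h0⟩)
    exact ⟨w, hw.1, hwx⟩
  exact ⟨Function.invFunOn_mem hex, Function.invFunOn_eq hex⟩

end Lambert

namespace RelayParams

variable (p : RelayParams)

theorem Gth_pos : 0 < p.Gth := by
  have h := Real.one_lt_rpow (x := 2) (z := 2 * p.R0) (by norm_num) (by linarith [p.R0_pos])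
  exact sub_pos.mpr h

theorem W2_pos : 0 < p.W2 :=
  div_pos (mul_pos p.noiseVar_pos (Real.rpow_pos_of_pos p.dSD_pos _)) p.PS_pos

theorem W3_pos : 0 < p.W3 :=
  div_pos (mul_pos p.noiseVar_pos (Real.rpow_pos_of_pos p.dRD_pos _)) two_pos

theorem W4_pos : 0 < p.W4 :=
  div_pos (mul_pos p.noiseVar_pos (Real.rpow_pos_of_pos p.dSR_pos _)) p.PS_pos

theorem W1_eq : p.W1 = p.W3 / p.M := by
  unfold W1 W3; rw [div_div]

theorem Gth_le_Gth' : (p.Gth : EReal) ≤ p.Gth' := by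
  unfold Gth'; split
  · exact le_rfl
  · exact le_top

theorem exp_W2_real_setOf_lt_Gth' :
    (expMeasure p.W2).real {s : ℝ | (s : EReal) < p.Gth'} = 1 - p.expNegW2Gth' := by
  have := isProbabilityMeasure_expMeasure p.W2_pos
  unfold expNegW2Gth' Gth'
  split
  · have h : {s : ℝ | (s : EReal) < p.Gth} = Set.Iio p.Gth := by ext s; simp
    rw [h, expMeasure_real_Iio p.W2_pos p.Gth_pos.le, ← EReal.coe_mul, ← EReal.coe_neg,
      EReal.exp_coe, ENNReal.toReal_ofReal (Real.exp_pos _).le]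
  · rw [EReal.coe_mul_top_of_pos p.W2_pos]
    simp [EReal.coe_lt_top]

/-- The probability that the direct link fails. -/
noncomputable def nackProb : ℝ := 1 - p.expNegW2Gth'

theorem nackProb_le_one : p.nackProb ≤ 1 := by
  have : 0 ≤ p.expNegW2Gth' := ENNReal.toReal_nonneg
  unfold nackProb; linarith

theorem nackProb_pos : 0 < p.nackProb := by
  have := isProbabilityMeasure_expMeasure p.W2_pos
  rw [nackProb, ← p.exp_W2_real_setOf_lt_Gth']
  have h1 : 0 < (expMeasure p.W2).real (Set.Iio p.Gth) := by
    rw [expMeasure_real_Iio p.W2_pos p.Gth_pos.le, sub_pos, Real.exp_lt_one_iff]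
    have := mul_pos p.W2_pos p.Gth_pos
    linarith
  exact h1.trans_le (measureReal_mono fun s hs =>
    (EReal.coe_lt_coe_iff.mpr hs).trans_le p.Gth_le_Gth')

theorem phiInc_eq : p.phiInc = p.M * p.lam1 * p.nackProb := rfl

/-- With `w` the Lambert value, `w exp w = -φ exp (-φ)` gives `w = -φ exp (-(w + φ))`, and `Z₁ M = w
+ φ`. The trivial root `w = -φ` is excluded because `w ≥ -1 > -φ`; this also gives positivity. -/
theorem Z1_spec (h : 1 < p.phiInc) :
    0 < p.Z1 ∧ p.Z1 = p.lam1 * p.nackProb * (1 - Real.exp (-(p.Z1 * p.M))) := by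
  have hM := p.M_pos
  have hphi : (1 - p.expNegW2Gth') * p.lam1 * p.M = p.phiInc := by unfold phiInc; ring
  -- The argument of the Lambert function lies in `[-exp (-1), 0]`.
  have hle : Real.exp (-p.phiInc) * p.phiInc ≤ Real.exp (-1) := by
    have h1 := Real.add_one_le_exp (p.phiInc - 1)
    calc Real.exp (-p.phiInc) * p.phiInc
        ≤ Real.exp (-p.phiInc) * Real.exp (p.phiInc - 1) := by gcongr; linarith
      _ = Real.exp (-1) := by rw [← Real.exp_add]; ring_nf
  obtain ⟨hw1, hw⟩ := lambertW_spec (x := -p.phiInc * Real.exp (-p.phiInc))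
    (by linarith) (by nlinarith [Real.exp_pos (-p.phiInc)])
  have hZ : p.Z1 = (lambertW (-p.phiInc * Real.exp (-p.phiInc)) + p.phiInc) / p.M := by
    unfold Z1
    rw [hphi, add_div]
    congr 1
    rw [← hphi]
    field_simp
  set w := lambertW (-p.phiInc * Real.exp (-p.phiInc))
  have hZM : p.Z1 * p.M = w + p.phiInc := by rw [hZ]; field_simp
  refine ⟨by rw [hZ]; exact div_pos (by linarith) hM, ?_⟩
  have hw2 : w = -p.phiInc * Real.exp (-(p.Z1 * p.M)) := by
    rw [hZM, neg_add, Real.exp_add, Real.exp_neg w]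
    have := Real.exp_pos w
    field_simp
    linarith
  have h3 : p.Z1 * p.M = p.lam1 * p.nackProb * (1 - Real.exp (-(p.Z1 * p.M))) * p.M := by
    rw [p.phiInc_eq] at *
    linarith
  exact mul_right_cancel₀ hM.ne' h3

/-! ### One interval: its inputs and the outage probability at a fixed relay power. -/

/-- The law of the SNRs of the links from the source, of the squared modulus of the channel from
the relay and of the harvested energy in one interval. -/
noncomputable def slotLaw : Measure (ℝ × ℝ × ℝ × ℝ) :=
  (expMeasure p.W2).prod ((expMeasure p.W4).prod
    ((expMeasure (p.dRD ^ p.α)).prod (expMeasure p.lam1)))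

theorem dRD_rpow_pos : 0 < p.dRD ^ p.α := Real.rpow_pos_of_pos p.dRD_pos _

instance isProbabilityMeasure_slotLaw : IsProbabilityMeasure p.slotLaw := by
  have := isProbabilityMeasure_expMeasure p.W2_pos
  have := isProbabilityMeasure_expMeasure p.W4_pos
  have := isProbabilityMeasure_expMeasure p.dRD_rpow_pos
  have := isProbabilityMeasure_expMeasure p.lam1_pos
  unfold slotLaw
  infer_instance

open Classical in
/-- The energy in the buffer after an interval that starts with energy `z.1`. -/
noncomputable def bufferStep (z : ℝ × (ℝ × ℝ × ℝ × ℝ)) : ℝ :=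
  if p.Gth' ≤ (z.2.1 : EReal) then z.1 + z.2.2.2.2 else max (z.1 - p.M) 0 + z.2.2.2.2

theorem measurable_bufferStep : Measurable p.bufferStep := by
  refine Measurable.ite ?_ (by fun_prop) (by fun_prop)
  exact measurableSet_le measurable_const
    (measurable_coe_real_ereal.comp (measurable_fst.comp measurable_snd))

theorem integral_bufferStep {f : ℝ → ℝ} (hf : Measurable f) {C : ℝ} (hC : ∀ x, |f x| ≤ C)
    (b : ℝ) :
    ∫ s, f (p.bufferStep (b, s)) ∂p.slotLaw = stepOp p.nackProb p.M (expMeasure p.lam1) f b := by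
  classical
  have := isProbabilityMeasure_expMeasure p.W2_pos
  have := isProbabilityMeasure_expMeasure p.W4_pos
  have := isProbabilityMeasure_expMeasure p.dRD_rpow_pos
  have := isProbabilityMeasure_expMeasure p.lam1_pos
  have hm := p.measurable_bufferStep
  unfold slotLaw
  rw [integral_prod _ (integrable_of_bounded (by fun_prop) fun s => hC _)]
  have hms : MeasurableSet {s : ℝ | (s : EReal) < p.Gth'} :=
    measurableSet_lt measurable_coe_real_ereal measurable_const
  -- The relay channels integrate out; what is left is a constant plus a correction on the event of
  -- a failed direct link.
  have h (s : ℝ) : ∫ y, f (p.bufferStep (b, s, y)) ∂((expMeasure p.W4).prod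
      ((expMeasure (p.dRD ^ p.α)).prod (expMeasure p.lam1)))
      = ∫ x, f (b + x) ∂(expMeasure p.lam1)
        + {s : ℝ | (s : EReal) < p.Gth'}.indicator (fun _ =>
          ∫ x, f (max (b - p.M) 0 + x) ∂(expMeasure p.lam1)
            - ∫ x, f (b + x) ∂(expMeasure p.lam1)) s := by
    simp only [bufferStep, Set.indicator_apply, Set.mem_ofPred_eq, ← not_le]
    split_ifs with hs
    · simp only [add_zero]
      rw [integral_fun_snd (f := fun y : ℝ × ℝ => f (b + y.2)),
        integral_fun_snd (f := fun y : ℝ => f (b + y))]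
      simp
    · rw [integral_fun_snd (f := fun y : ℝ × ℝ => f (max (b - p.M) 0 + y.2)),
        integral_fun_snd (f := fun y : ℝ => f (max (b - p.M) 0 + y))]
      simp
  simp_rw [h]
  rw [integral_add (integrable_const _) ((integrable_const _).indicator hms),
    integral_indicator hms]
  simp only [integral_const, measureReal_restrict_apply_univ, probReal_univ, smul_eq_mul,
    exp_W2_real_setOf_lt_Gth', stepOp, nackProb]
  ring

/-- The outage probability if the relay transmits with power `c` times the noise variance. -/
noncomputable def slotOutage (c : ℝ) : ℝ :=
  p.slotLaw.real {s | (s.1 : EReal) < p.Gth' ∧ min s.2.1 (c * s.2.2.1 + s.1) < p.Gth}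

theorem measurableSet_slotOutage {α : Type*} [MeasurableSpace α] {c s₁ s₂ s₃ : α → ℝ}
    (hc : Measurable c) (h₁ : Measurable s₁) (h₂ : Measurable s₂) (h₃ : Measurable s₃) :
    MeasurableSet {a | (s₁ a : EReal) < p.Gth' ∧ min (s₂ a) (c a * s₃ a + s₁ a) < p.Gth} :=
  (measurableSet_lt (measurable_coe_real_ereal.comp h₁) measurable_const).inter
    (measurableSet_lt (h₂.min ((hc.mul h₃).add h₁)) measurable_const)

theorem measurable_slotOutage : Measurable p.slotOutage := by
  have h : MeasurableSet {y : ℝ × (ℝ × ℝ × ℝ × ℝ) | (y.2.1 : EReal) < p.Gth' ∧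
      min y.2.2.1 (y.1 * y.2.2.2.1 + y.2.1) < p.Gth} :=
    p.measurableSet_slotOutage (by fun_prop) (by fun_prop) (by fun_prop) (by fun_prop)
  exact (measurable_measure_prodMk_left h).ennreal_toReal

theorem abs_slotOutage_le_one (c : ℝ) : |p.slotOutage c| ≤ 1 := by
  rw [slotOutage, abs_of_nonneg measureReal_nonneg]
  exact measureReal_le_one

/-- If the source-relay link fails, outage means that the direct link fails. Otherwise outage means
that the combined SNR is below `Γ_th`; as the relay's contribution is nonnegative, this already
forces `γ_SD < Γ_th ≤ Γ'_th`. -/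
theorem slotOutage_eq {c : ℝ} (hc : 0 ≤ c) :
    p.slotOutage c = (1 - Real.exp (-(p.W4 * p.Gth))) * p.nackProb
      + Real.exp (-(p.W4 * p.Gth)) * ((expMeasure p.W2).prod (expMeasure (p.dRD ^ p.α))).real
        {z : ℝ × ℝ | c * z.2 + z.1 < p.Gth} := by
  have := isProbabilityMeasure_expMeasure p.W2_pos
  have := isProbabilityMeasure_expMeasure p.W4_pos
  have := isProbabilityMeasure_expMeasure p.dRD_rpow_pos
  have := isProbabilityMeasure_expMeasure p.lam1_pos
  have hms : MeasurableSet {s : ℝ | (s : EReal) < p.Gth'} :=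
    measurableSet_lt measurable_coe_real_ereal measurable_const
  have hmz : MeasurableSet {z : ℝ × ℝ | c * z.2 + z.1 < p.Gth} :=
    measurableSet_lt (by fun_prop) (by fun_prop)
  set e := Real.exp (-(p.W4 * p.Gth)) with he
  set k : ℝ → ℝ := fun s => (expMeasure (p.dRD ^ p.α)).real
    (Prod.mk s ⁻¹' {z : ℝ × ℝ | c * z.2 + z.1 < p.Gth}) with hk
  have hkm : Measurable k := (measurable_measure_prodMk_left hmz).ennreal_toReal
  have hk1 (s : ℝ) : |k s| ≤ 1 := by
    rw [abs_of_nonneg measureReal_nonneg]; exact measureReal_le_one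
  rw [slotOutage, slotLaw, prod_real_apply
    (p.measurableSet_slotOutage (by fun_prop) (by fun_prop) (by fun_prop) (by fun_prop)),
    prod_real_apply hmz]
  have hsec (s : ℝ) : ((expMeasure p.W4).prod
      ((expMeasure (p.dRD ^ p.α)).prod (expMeasure p.lam1))).real (Prod.mk s ⁻¹'
        {s | (s.1 : EReal) < p.Gth' ∧ min s.2.1 (c * s.2.2.1 + s.1) < p.Gth})
      = {s : ℝ | (s : EReal) < p.Gth'}.indicator (fun _ => 1 - e) s + e * k s := by
    by_cases hs : (s : EReal) < p.Gth'
    -- Given a failed direct link, success is a rectangle, so its probability factorises.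
    · have hcompl : (Prod.mk s ⁻¹' {s : ℝ × ℝ × ℝ × ℝ |
          (s.1 : EReal) < p.Gth' ∧ min s.2.1 (c * s.2.2.1 + s.1) < p.Gth})ᶜ
          = (Set.Iio p.Gth)ᶜ ×ˢ
            ((Prod.mk s ⁻¹' {z : ℝ × ℝ | c * z.2 + z.1 < p.Gth})ᶜ ×ˢ Set.univ) := by
        ext ⟨a, b, x⟩
        simp [hs]
      have hm1 : MeasurableSet (Prod.mk s ⁻¹' {s : ℝ × ℝ × ℝ × ℝ |
          (s.1 : EReal) < p.Gth' ∧ min s.2.1 (c * s.2.2.1 + s.1) < p.Gth}) :=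
        measurable_prodMk_left
          (p.measurableSet_slotOutage (by fun_prop) (by fun_prop) (by fun_prop) (by fun_prop))
      have h1 := probReal_compl_eq_one_sub (μ := (expMeasure p.W4).prod
        ((expMeasure (p.dRD ^ p.α)).prod (expMeasure p.lam1))) hm1
      rw [hcompl, measureReal_prod_prod, measureReal_prod_prod,
        probReal_compl_eq_one_sub measurableSet_Iio,
        probReal_compl_eq_one_sub (measurable_prodMk_left hmz),
        expMeasure_real_Iio p.W4_pos p.Gth_pos.le, probReal_univ] at h1
      rw [Set.indicator_of_mem (show s ∈ {s : ℝ | (s : EReal) < p.Gth'} from hs)]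
      simp only [hk]
      linarith
    · have h1 : k s = 0 := by
        have hs' : p.Gth ≤ s :=
          EReal.coe_le_coe_iff.mp (p.Gth_le_Gth'.trans (not_lt.mp hs))
        rw [hk, measureReal_eq_zero_iff]
        refine measure_mono_null (fun y hy => ?_) (expMeasure_Iio_zero (p.dRD ^ p.α))
        simp only [Set.mem_preimage, Set.mem_ofPred_eq] at hy
        by_contra hy0
        have : 0 ≤ c * y := mul_nonneg hc (not_lt.mp hy0)
        linarith
      rw [Set.indicator_of_notMem (show s ∉ {s : ℝ | (s : EReal) < p.Gth'} from hs), h1]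
      simp [Set.preimage, hs]
  simp_rw [hsec]
  rw [integral_add ((integrable_const _).indicator hms)
    ((integrable_of_bounded hkm hk1).const_mul _), integral_const_mul, integral_indicator hms]
  simp only [integral_const, measureReal_restrict_apply_univ, smul_eq_mul,
    exp_W2_real_setOf_lt_Gth', nackProb, hk]
  ring

/-- The probability that the sum of the SNRs of the link from the source and of a link whose SNR is
exponential with rate `w` is below the threshold (for `w ≠ W₂`). -/
noncomputable def sumOutage (w : ℝ) : ℝ :=
  (1 - Real.exp (-(p.W2 * p.Gth)))
    + p.W2 * (Real.exp (-(w * p.Gth)) - Real.exp (-(p.W2 * p.Gth))) / (w - p.W2)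

theorem slotOutage_eq_sumOutage {c : ℝ} (hc : 0 < c) (hne : p.dRD ^ p.α / c ≠ p.W2) :
    p.slotOutage c = (1 - Real.exp (-(p.W4 * p.Gth))) * p.nackProb
      + Real.exp (-(p.W4 * p.Gth)) * p.sumOutage (p.dRD ^ p.α / c) := by
  have := isProbabilityMeasure_expMeasure p.W2_pos
  have := isProbabilityMeasure_expMeasure p.dRD_rpow_pos
  rw [slotOutage_eq p hc.le, sumOutage, ← expMeasure_prod_real_add_lt p.W2_pos
    (div_pos p.dRD_rpow_pos hc) hne p.Gth_pos.le, ← expMeasure_map_mul p.dRD_rpow_pos hc]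
  congr 2
  have h : (expMeasure p.W2).prod ((expMeasure (p.dRD ^ p.α)).map fun x => c * x)
      = ((expMeasure p.W2).prod (expMeasure (p.dRD ^ p.α))).map
        (Prod.map id fun x => c * x) := by
    rw [← Measure.map_prod_map _ _ measurable_id (by fun_prop), Measure.map_id]
  rw [h, map_measureReal_apply (by fun_prop) (measurableSet_lt (by fun_prop) (by fun_prop))]
  rfl

/-! ### Outage as a function of the stored energy, and its average under the exponential law. -/

/-- The outage probability under the policy if the buffer holds the energy `b`. -/
noncomputable def bufferOutage (b : ℝ) : ℝ := p.slotOutage (min b p.M / (1 / 2) / p.noiseVar)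

theorem measurable_bufferOutage : Measurable p.bufferOutage :=
  p.measurable_slotOutage.comp (by fun_prop)

theorem abs_bufferOutage_le_one (b : ℝ) : |p.bufferOutage b| ≤ 1 := p.abs_slotOutage_le_one _

theorem bufferOutage_of_le {b : ℝ} (hb : p.M ≤ b) : p.bufferOutage b = p.bufferOutage p.M := by
  unfold bufferOutage; rw [min_eq_right hb, min_self]

theorem bufferOutage_eq {b : ℝ} (hb : 0 < b) (hne : p.W3 / min b p.M ≠ p.W2) :
    p.bufferOutage b = (1 - Real.exp (-(p.W4 * p.Gth))) * p.nackProb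
      + Real.exp (-(p.W4 * p.Gth)) * p.sumOutage (p.W3 / min b p.M) := by
  have hm : 0 < min b p.M := lt_min hb p.M_pos
  have hn := p.noiseVar_pos
  have h : p.dRD ^ p.α / (min b p.M / (1 / 2) / p.noiseVar) = p.W3 / min b p.M := by
    unfold W3; field_simp
  rw [← h] at hne ⊢
  exact p.slotOutage_eq_sumOutage (by positivity) hne

/-- `W₁ ≠ W₂` keeps the closed form away from its singularity in a neighbourhood of `M`. -/
theorem continuousAt_bufferOutage (hW : p.W1 ≠ p.W2) : ContinuousAt p.bufferOutage p.M := by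
  have hM := p.M_pos
  rw [W1_eq] at hW
  have h1 : ContinuousAt (fun b => p.W3 / min b p.M) p.M :=
    continuousAt_const.div (by fun_prop) (by simpa using hM.ne')
  have h2 : ∀ᶠ b in 𝓝 p.M, p.W3 / min b p.M ≠ p.W2 :=
    h1.eventually_ne (by simpa using hW)
  have h3 : ContinuousAt (fun b => (1 - Real.exp (-(p.W4 * p.Gth))) * p.nackProb
      + Real.exp (-(p.W4 * p.Gth)) * p.sumOutage (p.W3 / min b p.M)) p.M := by
    have h4 : ContinuousAt p.sumOutage (p.W3 / min p.M p.M) := by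
      unfold sumOutage
      have : p.W3 / min p.M p.M - p.W2 ≠ 0 := sub_ne_zero.mpr (by simpa using hW)
      fun_prop (disch := assumption)
    exact continuousAt_const.add (continuousAt_const.mul
      (ContinuousAt.comp (f := fun b => p.W3 / min b p.M) h4 h1))
  refine h3.congr ?_
  filter_upwards [h2, lt_mem_nhds hM] with b hb hb0
  exact (p.bufferOutage_eq hb0 hb).symm

theorem bufferOutage_M (hW : p.W1 ≠ p.W2) :
    p.bufferOutage p.M = (1 - Real.exp (-(p.W4 * p.Gth))) * p.nackProb
      + Real.exp (-(p.W4 * p.Gth)) * p.sumOutage p.W1 := by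
  rw [W1_eq] at *
  have h := p.bufferOutage_eq p.M_pos (by simpa using hW)
  rwa [min_self] at h

theorem integrandHSU_eq {x : ℝ} (hx : 0 < x) (hne : p.W3 / x ≠ p.W2) :
    p.W2 * p.integrandHSU x = Real.exp (-(p.Z1 * x)) *
      (p.sumOutage (p.W3 / x) - (1 - Real.exp (-(p.W2 * p.Gth)))) := by
  unfold integrandHSU sumOutage
  have h1 : p.W3 - x * p.W2 ≠ 0 := fun h => hne (by field_simp; linarith)
  have h2 : x * p.W2 - p.W3 = -(p.W3 - x * p.W2) := by ring
  have h3 : p.W3 / x - p.W2 = (p.W3 - x * p.W2) / x := by field_simp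
  have h4 : p.W3 / x * p.Gth = p.W3 * p.Gth / x := by ring
  rw [h2, h3, h4]
  field_simp
  ring

/-- The integrand is the excess of the outage probability over that of a silent relay. Only the null
set `x = W₃ / W₂`, where its denominator vanishes, is excluded. -/
theorem ae_integrandHSU_eq : ∀ᵐ x ∂volume.restrict (Set.Ioc 0 p.M),
    Real.exp (-(p.W4 * p.Gth)) * (p.W2 * p.integrandHSU x) = Real.exp (-(p.Z1 * x)) *
      (p.bufferOutage x - ((1 - Real.exp (-(p.W4 * p.Gth))) * p.nackProb
        + Real.exp (-(p.W4 * p.Gth)) * (1 - Real.exp (-(p.W2 * p.Gth))))) := by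
  have hne : ∀ᵐ x ∂volume.restrict (Set.Ioc 0 p.M), x ≠ p.W3 / p.W2 :=
    ae_restrict_of_ae (by simp [ae_iff])
  filter_upwards [ae_restrict_mem measurableSet_Ioc, hne] with x hx hx1
  have h1 : p.W3 / x ≠ p.W2 := by
    have := p.W2_pos
    have := hx.1
    intro h
    apply hx1
    rw [← h]
    have := p.W3_pos
    field_simp
  rw [p.integrandHSU_eq hx.1 h1, p.bufferOutage_eq hx.1 (by rwa [min_eq_left hx.2]),
    min_eq_left hx.2]
  ring

/-- The singularity needs no analysis: almost everywhere the integrand is a constant times a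
continuous function times a bounded one, since outage probabilities are bounded. -/
theorem intervalIntegrable_integrandHSU : IntervalIntegrable p.integrandHSU volume 0 p.M := by
  have he := Real.exp_pos (-(p.W4 * p.Gth))
  have h2 := p.W2_pos
  rw [intervalIntegrable_iff_integrableOn_Ioc_of_le p.M_pos.le]
  have hb : Integrable (fun x => p.bufferOutage x
      - ((1 - Real.exp (-(p.W4 * p.Gth))) * p.nackProb
        + Real.exp (-(p.W4 * p.Gth)) * (1 - Real.exp (-(p.W2 * p.Gth)))))
      (volume.restrict (Set.Ioc 0 p.M)) :=
    (integrable_of_bounded p.measurable_bufferOutage p.abs_bufferOutage_le_one).sub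
      (integrable_const _)
  have hc : IntegrableOn (fun x => Real.exp (-(p.Z1 * x)) *
      (p.bufferOutage x - ((1 - Real.exp (-(p.W4 * p.Gth))) * p.nackProb
        + Real.exp (-(p.W4 * p.Gth)) * (1 - Real.exp (-(p.W2 * p.Gth))))))
      (Set.Ioc 0 p.M) := by
    have hcont : ContinuousOn (fun x => Real.exp (-(p.Z1 * x))) (Set.Icc 0 p.M) := by fun_prop
    rw [← integrableOn_Icc_iff_integrableOn_Ioc]
    refine IntegrableOn.continuousOn_mul hcont ?_ isCompact_Icc
    rw [integrableOn_Icc_iff_integrableOn_Ioc]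
    exact hb
  have hd := (hc.congr (p.ae_integrandHSU_eq.mono fun x hx => hx.symm)).const_mul
    (Real.exp (-(p.W4 * p.Gth)) * p.W2)⁻¹
  refine hd.congr (Eventually.of_forall fun x => ?_)
  field_simp

/-- The outage probability if the stored energy follows the limiting exponential law. -/
theorem integral_bufferOutage (hW : p.W1 ≠ p.W2) (hZ : 0 < p.Z1) :
    ∫ b, p.bufferOutage b ∂(expMeasure p.Z1)
      = (1 - Real.exp (-(p.W4 * p.Gth))) * p.nackProb + Real.exp (-(p.W4 * p.Gth)) *
        (Real.exp (-(p.Z1 * p.M)) * p.sumOutage p.W1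
          + (1 - Real.exp (-(p.Z1 * p.M))) * (1 - Real.exp (-(p.W2 * p.Gth))) + p.IHSU) := by
  have := isProbabilityMeasure_expMeasure hZ
  -- `A` is the outage probability of a silent relay. The excess over it integrates to the `IHSU`
  -- term on `(0, M]` and is constant beyond `M`.
  set A := (1 - Real.exp (-(p.W4 * p.Gth))) * p.nackProb
    + Real.exp (-(p.W4 * p.Gth)) * (1 - Real.exp (-(p.W2 * p.Gth))) with hA
  have hsub : ∫ b, p.bufferOutage b ∂(expMeasure p.Z1)
      = A + ∫ b, (p.bufferOutage b - A) ∂(expMeasure p.Z1) := by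
    rw [integral_sub (integrable_of_bounded p.measurable_bufferOutage p.abs_bufferOutage_le_one)
      (integrable_const _)]
    simp
  have hexp : IntegrableOn (fun x => p.Z1 * Real.exp (-(p.Z1 * x))) (Set.Ioi 0) := by
    have := (integrableOn_exp_mul_Ioi (show -p.Z1 < 0 by linarith) 0).const_mul p.Z1
    simpa [IntegrableOn] using this
  have hint : IntegrableOn (fun x => (p.Z1 * Real.exp (-(p.Z1 * x))) • (p.bufferOutage x - A))
      (Set.Ioi 0) := by
    refine Integrable.mul_bdd (c := 1 + |A|) hexp
      (p.measurable_bufferOutage.sub_const A).aestronglyMeasurable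
      (Eventually.of_forall fun x => ?_)
    exact (norm_sub_le _ _).trans (by gcongr; exacts [p.abs_bufferOutage_le_one x, le_rfl])
  have htail : ∫ x in Set.Ioi p.M, (p.Z1 * Real.exp (-(p.Z1 * x))) • (p.bufferOutage x - A)
      = Real.exp (-(p.Z1 * p.M)) * (p.bufferOutage p.M - A) := by
    have h1 : ∫ x in Set.Ioi p.M, (p.Z1 * Real.exp (-(p.Z1 * x))) • (p.bufferOutage x - A)
        = ∫ x in Set.Ioi p.M, (p.Z1 * (p.bufferOutage p.M - A)) * Real.exp (-p.Z1 * x) := by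
      refine setIntegral_congr_fun measurableSet_Ioi fun x hx => ?_
      simp only [p.bufferOutage_of_le (le_of_lt hx), smul_eq_mul, neg_mul]
      ring
    rw [h1, integral_const_mul, integral_exp_mul_Ioi (by linarith)]
    have := hZ.ne'
    simp only [neg_mul]
    field_simp
  have hhead : ∫ x in Set.Ioc 0 p.M, (p.Z1 * Real.exp (-(p.Z1 * x))) • (p.bufferOutage x - A)
      = Real.exp (-(p.W4 * p.Gth)) * p.IHSU := by
    rw [IHSU, intervalIntegral.integral_of_le p.M_pos.le, ← integral_const_mul,
      ← integral_const_mul]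
    refine integral_congr_ae ?_
    filter_upwards [p.ae_integrandHSU_eq] with x hx
    rw [smul_eq_mul, mul_assoc, ← hx]
    ring
  rw [hsub, integral_expMeasure hZ, ← Set.Ioc_union_Ioi_eq_Ioi p.M_pos.le,
    setIntegral_union (Set.Ioc_disjoint_Ioi le_rfl) measurableSet_Ioi
      (hint.mono_set Set.Ioc_subset_Ioi_self) (hint.mono_set (Set.Ioi_subset_Ioi p.M_pos.le)),
    hhead, htail, p.bufferOutage_M hW, hA]
  ring

end RelayParams

/-! ### The evolution of the network -/

theorem complexGaussian_map_mul_norm_sq {d α c : ℝ} (hd : 0 < d) (hc : 0 < c) :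
    (complexGaussian (d ^ (-α)).toNNReal).map (fun z => c * ‖z‖ ^ 2) = expMeasure (d ^ α / c) := by
  have hv : 0 < d ^ (-α) := Real.rpow_pos_of_pos hd _
  have h : (fun z : ℂ => c * ‖z‖ ^ 2) = (fun x : ℝ => c * x) ∘ fun z : ℂ => ‖z‖ ^ 2 := rfl
  rw [h, ← Measure.map_map (by fun_prop) (by fun_prop),
    complexGaussian_map_norm_sq (Real.toNNReal_pos.mpr hv), Real.coe_toNNReal _ hv.le,
    Real.rpow_neg hd.le, inv_inv, expMeasure_map_mul (Real.rpow_pos_of_pos hd _) hc]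

/-- If `f` is independent of `(g, h)` and `g` is independent of `h`, then `(f, g)` is independent
of `h`. -/
theorem indepFun_prodMk_of_indepFun {Ω α β γ : Type*} [MeasurableSpace Ω] [MeasurableSpace α]
    [MeasurableSpace β] [MeasurableSpace γ] {P : Measure Ω} [IsProbabilityMeasure P]
    {f : Ω → α} {g : Ω → β} {h : Ω → γ} (hf : Measurable f) (hg : Measurable g)
    (hh : Measurable h) (hfgh : IndepFun f (fun ω => (g ω, h ω)) P) (hgh : IndepFun g h P) :
    IndepFun (fun ω => (f ω, g ω)) h P := by
  have hfg : IndepFun f g P := hfgh.comp measurable_id measurable_fst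
  have := Measure.isProbabilityMeasure_map (μ := P) hf.aemeasurable
  have := Measure.isProbabilityMeasure_map (μ := P) hg.aemeasurable
  have := Measure.isProbabilityMeasure_map (μ := P) hh.aemeasurable
  rw [indepFun_iff_map_prod_eq_prod_map_map (by fun_prop) (by fun_prop)] at *
  have hmap : (fun ω => ((f ω, g ω), h ω)) = MeasurableEquiv.prodAssoc.symm ∘
      fun ω => (f ω, g ω, h ω) := rfl
  rw [hfg, hmap, ← Measure.map_map (by fun_prop) (by fun_prop), hfgh, hgh,
    ← Measure.prodAssoc_prod, MeasurableEquiv.map_symm_map]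

namespace RelayModel

variable {p : RelayParams} {Ω : Type*} [MeasurableSpace Ω] {P : Measure Ω} (m : RelayModel p P)

/-- The SNRs of the links from the source, the squared modulus of the channel from the relay and
the harvested energy in interval `i`. -/
noncomputable def slot (i : ℕ) (ω : Ω) : ℝ × ℝ × ℝ × ℝ :=
  (m.snrSD i ω, m.snrSR i ω, ‖m.hRD i ω‖ ^ 2, m.X i ω)

theorem slot_eq (i : ℕ) : m.slot i = (Prod.map (fun z : ℂ => p.PS * ‖z‖ ^ 2 / p.noiseVar)
    (Prod.map (fun z : ℂ => p.PS * ‖z‖ ^ 2 / p.noiseVar)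
      (Prod.map (fun z : ℂ => ‖z‖ ^ 2) (id : ℝ → ℝ)))) ∘
    fun ω => (m.hSD i ω, m.hSR i ω, m.hRD i ω, m.X i ω) := rfl

theorem measurable_slot (i : ℕ) : Measurable (m.slot i) := by
  have := m.measurable_hSD i
  have := m.measurable_hSR i
  have := m.measurable_hRD i
  have := m.measurable_X i
  unfold slot snrSD snrSR
  fun_prop

theorem map_slot (i : ℕ) : P.map (m.slot i) = p.slotLaw := by
  have := m.measurable_hSD i
  have := m.measurable_hSR i
  have := m.measurable_hRD i
  have := m.measurable_X i
  have := isProbabilityMeasure_expMeasure p.lam1_pos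
  have hPS := p.PS_pos
  have hn := p.noiseVar_pos
  have hsrc {d : ℝ} (hd : 0 < d) : (complexGaussian (d ^ (-p.α)).toNNReal).map
      (fun z => p.PS * ‖z‖ ^ 2 / p.noiseVar) = expMeasure (p.noiseVar * d ^ p.α / p.PS) := by
    have h := complexGaussian_map_mul_norm_sq (α := p.α) hd (div_pos hPS hn)
    rw [show p.noiseVar * d ^ p.α / p.PS = d ^ p.α / (p.PS / p.noiseVar) by field_simp, ← h]
    congr 1
    ext z
    ring
  have hrel : (complexGaussian (p.dRD ^ (-p.α)).toNNReal).map (fun z => ‖z‖ ^ 2)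
      = expMeasure (p.dRD ^ p.α) := by
    simpa using complexGaussian_map_mul_norm_sq (α := p.α) p.dRD_pos one_pos
  rw [slot_eq, ← Measure.map_map (by fun_prop) (by fun_prop), m.law_slot i,
    ← Measure.map_prod_map _ _ (by fun_prop) (by fun_prop),
    ← Measure.map_prod_map _ _ (by fun_prop) (by fun_prop),
    ← Measure.map_prod_map _ _ (by fun_prop) (by fun_prop),
    hsrc p.dSD_pos, hsrc p.dSR_pos, hrel, Measure.map_id]
  rfl

theorem iIndepFun_slot : iIndepFun m.slot P :=
  m.indep_slots.comp (fun _ => Prod.map (fun z : ℂ => p.PS * ‖z‖ ^ 2 / p.noiseVar)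
    (Prod.map (fun z : ℂ => p.PS * ‖z‖ ^ 2 / p.noiseVar)
      (Prod.map (fun z : ℂ => ‖z‖ ^ 2) (id : ℝ → ℝ)))) fun _ => by fun_prop

theorem indepFun_B0_slot : IndepFun m.B0 (fun ω i => m.slot i ω) P := by
  have h : Measurable fun (s : ℕ → ℂ × ℂ × ℂ × ℝ) (i : ℕ) =>
      (Prod.map (fun z : ℂ => p.PS * ‖z‖ ^ 2 / p.noiseVar)
        (Prod.map (fun z : ℂ => p.PS * ‖z‖ ^ 2 / p.noiseVar)
          (Prod.map (fun z : ℂ => ‖z‖ ^ 2) (id : ℝ → ℝ)))) (s i) := by fun_prop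
  exact m.indep_initial.comp measurable_id h

/-- Both cases after a failed direct link are instances of `max (b - M) 0 + X`. -/
theorem energy_succ (i : ℕ) (ω : Ω) :
    m.energy (i + 1) ω = p.bufferStep (m.energy i ω, m.slot i ω) := by
  by_cases h1 : p.Gth' ≤ (m.snrSD i ω : EReal)
  · exact (if_pos h1).trans (if_pos h1).symm
  · refine (if_neg h1).trans (Eq.trans ?_ (if_neg h1).symm)
    simp only [slot]
    split_ifs with h2
    · rw [max_eq_left (by linarith)]
    · rw [max_eq_right (by linarith), zero_add]

/-- The buffer does not look ahead: only intervals before `n` enter, whence the independence of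
`B(n)` from the inputs of interval `n`. -/
theorem exists_energy_eq (n : ℕ) :
    ∃ F : ℝ × (Finset.range n → ℝ × ℝ × ℝ × ℝ) → ℝ, Measurable F ∧
      ∀ ω, m.energy n ω = F (m.B0 ω, fun i => m.slot i ω) := by
  induction n with
  | zero => exact ⟨Prod.fst, measurable_fst, fun ω => rfl⟩
  | succ n ih =>
    obtain ⟨F, hF, hFe⟩ := ih
    refine ⟨fun y => p.bufferStep
      (F (y.1, fun i => y.2 ⟨i, Finset.mem_range.mpr
        ((Finset.mem_range.mp i.2).trans n.lt_succ_self)⟩),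
        y.2 ⟨n, Finset.self_mem_range_succ n⟩), ?_, fun ω => ?_⟩
    · refine p.measurable_bufferStep.comp (Measurable.prodMk (hF.comp ?_) (by fun_prop))
      fun_prop
    · rw [energy_succ, hFe]

theorem measurable_energy (n : ℕ) : Measurable (m.energy n) := by
  obtain ⟨F, hF, hFe⟩ := m.exists_energy_eq n
  rw [funext hFe]
  exact hF.comp (m.measurable_B0.prodMk (measurable_pi_lambda _ fun i => m.measurable_slot i))

theorem ae_nonneg_map_B0 : ∀ᵐ b ∂(P.map m.B0), 0 ≤ b :=
  (ae_map_iff m.measurable_B0.aemeasurable measurableSet_Ici).mpr m.B0_nonneg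

theorem measurable_snrSD (i : ℕ) : Measurable (m.snrSD i) := (m.measurable_slot i).fst

theorem measurableSet_nackEvent (i : ℕ) : MeasurableSet (m.nackEvent i) :=
  measurableSet_lt (measurable_coe_real_ereal.comp (m.measurable_snrSD i)) measurable_const

variable [IsProbabilityMeasure P]

theorem indepFun_energy_slot (n : ℕ) : IndepFun (m.energy n) (m.slot n) P := by
  obtain ⟨F, hF, hFe⟩ := m.exists_energy_eq n
  have hpast : IndepFun (fun ω (i : Finset.range n) => m.slot i ω) (m.slot n) P := by
    have h := m.iIndepFun_slot.indepFun_finset (Finset.range n) {n} (by simp) m.measurable_slot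
    exact h.comp measurable_id (measurable_pi_apply (⟨n, by simp⟩ : ({n} : Finset ℕ)))
  have hall : IndepFun m.B0 (fun ω => (fun (i : Finset.range n) => m.slot i ω, m.slot n ω)) P :=
    m.indepFun_B0_slot.comp measurable_id (ψ := fun s : ℕ → ℝ × ℝ × ℝ × ℝ =>
      (fun (i : Finset.range n) => s i, s n)) (by fun_prop)
  have hmeas : Measurable fun ω (i : Finset.range n) => m.slot i ω :=
    measurable_pi_lambda _ fun i => m.measurable_slot i
  have h := indepFun_prodMk_of_indepFun m.measurable_B0 hmeas (m.measurable_slot n) hall hpast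
  rw [funext hFe]
  exact h.comp hF measurable_id

theorem map_energy_slot (n : ℕ) :
    P.map (fun ω => (m.energy n ω, m.slot n ω)) = (P.map (m.energy n)).prod p.slotLaw := by
  rw [← m.map_slot n]
  exact (indepFun_iff_map_prod_eq_prod_map_map (m.measurable_energy n).aemeasurable
    (m.measurable_slot n).aemeasurable).mp (m.indepFun_energy_slot n)

theorem map_energy_succ (n : ℕ) : P.map (m.energy (n + 1))
    = stepLaw p.nackProb p.M (expMeasure p.lam1) (P.map (m.energy n)) := by
  have := isProbabilityMeasure_expMeasure p.lam1_pos
  have := Measure.isProbabilityMeasure_map (μ := P) (m.measurable_energy n).aemeasurable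
  have := Measure.isProbabilityMeasure_map (μ := P) (m.measurable_energy (n + 1)).aemeasurable
  have := isProbabilityMeasure_stepLaw (M := p.M) (ε := expMeasure p.lam1)
    (ν := P.map (m.energy n)) p.nackProb_pos.le p.nackProb_le_one
  refine Measure.ext fun s hs => (measureReal_eq_measureReal_iff
    (measure_ne_top _ _) (measure_ne_top _ _)).mp ?_
  have hf : Measurable (s.indicator fun _ => (1 : ℝ)) := measurable_const.indicator hs
  have hC (x : ℝ) : |s.indicator (fun _ => (1 : ℝ)) x| ≤ 1 := by
    by_cases hx : x ∈ s <;> simp [hx]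
  have hreal (μ : Measure ℝ) : μ.real s = ∫ x, s.indicator (fun _ => (1 : ℝ)) x ∂μ := by
    rw [integral_indicator hs]; simp
  have hm := p.measurable_bufferStep
  have hint : Integrable (fun y => s.indicator (fun _ => (1 : ℝ)) (p.bufferStep y))
      ((P.map (m.energy n)).prod p.slotLaw) :=
    integrable_of_bounded (hf.comp hm) fun y => hC _
  rw [hreal, hreal, integral_stepLaw p.nackProb_pos.le p.nackProb_le_one hf hC,
    funext (m.energy_succ n),
    show (fun ω => p.bufferStep (m.energy n ω, m.slot n ω))
      = p.bufferStep ∘ fun ω => (m.energy n ω, m.slot n ω) from rfl,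
    ← Measure.map_map hm ((m.measurable_energy n).prodMk (m.measurable_slot n)),
    m.map_energy_slot, integral_map hm.aemeasurable hf.aestronglyMeasurable,
    integral_prod _ hint]
  exact integral_congr_ae (Eventually.of_forall fun b => p.integral_bufferStep hf hC b)

theorem map_energy (n : ℕ) : P.map (m.energy n)
    = (stepLaw p.nackProb p.M (expMeasure p.lam1))^[n] (P.map m.B0) := by
  induction n with
  | zero => rfl
  | succ n ih => rw [Function.iterate_succ_apply', ← ih, map_energy_succ]

theorem ae_nonneg_map_energy (n : ℕ) : ∀ᵐ b ∂(P.map (m.energy n)), 0 ≤ b := by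
  have := isProbabilityMeasure_expMeasure p.lam1_pos
  have := Measure.isProbabilityMeasure_map (μ := P) m.measurable_B0.aemeasurable
  rw [map_energy]
  exact ae_nonneg_iterate_stepLaw p.nackProb_pos.le p.nackProb_le_one
    (expMeasure_ae_pos p.lam1) m.ae_nonneg_map_B0 n

/-- The outage probability if the relay power is a function of the stored energy. -/
theorem outageProb_eq_integral {ρ : ℝ → ℝ} (hρ : Measurable ρ) (i : ℕ) :
    m.outageProb (fun ω => ρ (m.energy i ω)) i
      = ∫ b, p.slotOutage (ρ b / p.noiseVar) ∂(P.map (m.energy i)) := by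
  have hS : MeasurableSet {y : ℝ × (ℝ × ℝ × ℝ × ℝ) | (y.2.1 : EReal) < p.Gth' ∧
      min y.2.2.1 (ρ y.1 / p.noiseVar * y.2.2.2.1 + y.2.1) < p.Gth} :=
    p.measurableSet_slotOutage (by fun_prop) (by fun_prop) (by fun_prop) (by fun_prop)
  have h1 : m.outageProb (fun ω => ρ (m.energy i ω)) i
      = P.real ((fun ω => (m.energy i ω, m.slot i ω)) ⁻¹'
        {y : ℝ × (ℝ × ℝ × ℝ × ℝ) | (y.2.1 : EReal) < p.Gth' ∧
          min y.2.2.1 (ρ y.1 / p.noiseVar * y.2.2.2.1 + y.2.1) < p.Gth}) := by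
    -- The product of the failure probability and the conditional probability is the probability of
    -- the intersection.
    rw [outageProb, mul_comm, measureReal_def, measureReal_def, ← ENNReal.toReal_mul,
      cond_mul_eq_inter (m.measurableSet_nackEvent i), measureReal_def]
    congr 2
    ext ω
    simp only [nackEvent, snrRD, slot, Set.mem_inter_iff, Set.mem_ofPred_eq, Set.mem_preimage,
      mul_div_right_comm]
  rw [h1, ← map_measureReal_apply ((m.measurable_energy i).prodMk (m.measurable_slot i)) hS,
    map_energy_slot, prod_real_apply hS]
  rfl

theorem outageProb_relayPower (i : ℕ) : m.outageProb (m.relayPower i) i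
    = ∫ b, p.bufferOutage b ∂(P.map (m.energy i)) :=
  m.outageProb_eq_integral (ρ := fun b => min b p.M / (1 / 2)) (by fun_prop) i

theorem outageProb_const (i : ℕ) : m.outageProb (fun _ => 2 * p.M) i = p.bufferOutage p.M := by
  have := Measure.isProbabilityMeasure_map (μ := P) (m.measurable_energy i).aemeasurable
  rw [m.outageProb_eq_integral (ρ := fun _ => 2 * p.M) (by fun_prop) i, RelayParams.bufferOutage]
  have h : min p.M p.M / (1 / 2) = 2 * p.M := by rw [min_self]; ring
  simp only [h, integral_const, probReal_univ, one_smul]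

/-- Convergence of the outage probability to that of the limiting exponential law. -/
theorem tendsto_outageProb_of_one_lt (h : 1 < p.phiInc) :
    Tendsto (fun i => m.outageProb (m.relayPower i) i) atTop
      (𝓝 (∫ b, p.bufferOutage b ∂(expMeasure p.Z1))) := by
  have := Measure.isProbabilityMeasure_map (μ := P) m.measurable_B0.aemeasurable
  obtain ⟨hZ, hZe⟩ := p.Z1_spec h
  simp_rw [outageProb_relayPower, map_energy]
  exact tendsto_integral_iterate_stepLaw p.nackProb_pos.le p.nackProb_le_one p.M_pos p.lam1_pos
    (p.phiInc_eq ▸ h) hZ hZe p.measurable_bufferOutage p.abs_bufferOutage_le_one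
    m.ae_nonneg_map_B0

/-- Equal laws at `i` and `i + 1` mean that the law of `B(i)` is fixed by `stepLaw`. The sequence
started from it is constant and still converges to the exponential average, so the two agree. -/
theorem outageProb_eq_of_identDistrib (h : 1 < p.phiInc) {i : ℕ}
    (hi : IdentDistrib (m.energy (i + 1)) (m.energy i) P P) :
    m.outageProb (m.relayPower i) i = ∫ b, p.bufferOutage b ∂(expMeasure p.Z1) := by
  have := Measure.isProbabilityMeasure_map (μ := P) (m.measurable_energy i).aemeasurable
  obtain ⟨hZ, hZe⟩ := p.Z1_spec h
  have hfix : stepLaw p.nackProb p.M (expMeasure p.lam1) (P.map (m.energy i))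
      = P.map (m.energy i) := by rw [← m.map_energy_succ, hi.map_eq]
  have hlim := tendsto_integral_iterate_stepLaw p.nackProb_pos.le p.nackProb_le_one p.M_pos
    p.lam1_pos (p.phiInc_eq ▸ h) hZ hZe p.measurable_bufferOutage p.abs_bufferOutage_le_one
    (m.ae_nonneg_map_energy i)
  simp_rw [Function.iterate_fixed hfix] at hlim
  rw [outageProb_relayPower]
  exact tendsto_nhds_unique tendsto_const_nhds hlim

/-- Convergence of the outage probability to that of a relay with full power. -/
theorem tendsto_outageProb_of_le_one (hW : p.W1 ≠ p.W2) (h : p.phiInc ≤ 1) :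
    Tendsto (fun i => m.outageProb (m.relayPower i) i) atTop (𝓝 (p.bufferOutage p.M)) := by
  have := Measure.isProbabilityMeasure_map (μ := P) m.measurable_B0.aemeasurable
  simp_rw [outageProb_relayPower, map_energy]
  exact tendsto_integral_iterate_stepLaw_of_le_one p.nackProb_pos p.nackProb_le_one p.M_pos
    p.lam1_pos (p.phiInc_eq ▸ h) p.measurable_bufferOutage p.abs_bufferOutage_le_one
    (fun b hb => p.bufferOutage_of_le hb) (p.continuousAt_bufferOutage hW) m.ae_nonneg_map_B0

end RelayModel

/-- Outage probability of incremental decode-and-forward relaying with an infinite energy buffer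
operated by the incremental best-effort policy, in steady state. For `φ_inc > 1` it is the outage
probability under any stationary law of the buffer, and the limit of the outage probabilities of
interval `i` from any initial law; for `φ_inc ≤ 1` it is the outage probability with relay
power `2 M`, and the limit of the actual outage probabilities from any initial law. -/
theorem theorem5 (p : RelayParams) (hW : p.W1 ≠ p.W2)
    {Ω : Type*} [MeasurableSpace Ω] (P : Measure Ω) [IsProbabilityMeasure P]
    (m : RelayModel p P) :
    (1 < p.phiInc →
      ∃ Pout : ℝ,
        Pout = (1 - Real.exp (-(p.W4 * p.Gth))) * (1 - p.expNegW2Gth')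
          + Real.exp (-(p.W4 * p.Gth)) *
            (Real.exp (-(p.Z1 * p.M)) *
                ((1 - Real.exp (-(p.W2 * p.Gth)))
                  + p.W2 * (Real.exp (-(p.W1 * p.Gth)) - Real.exp (-(p.W2 * p.Gth)))
                      / (p.W1 - p.W2))
              + (1 - Real.exp (-(p.Z1 * p.M))) * (1 - Real.exp (-(p.W2 * p.Gth)))
              + p.IHSU) ∧
        IntervalIntegrable p.integrandHSU volume 0 p.M ∧
        (∀ i : ℕ, IdentDistrib (m.energy (i + 1)) (m.energy i) P P →
          m.outageProb (m.relayPower i) i = Pout) ∧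
        Tendsto (fun i : ℕ => m.outageProb (m.relayPower i) i) atTop (𝓝 Pout)) ∧
    (p.phiInc ≤ 1 →
      ∃ Pout : ℝ,
        Pout = (1 - Real.exp (-(p.W4 * p.Gth))) * (1 - p.expNegW2Gth')
          + Real.exp (-(p.W4 * p.Gth)) *
            ((1 - Real.exp (-(p.W2 * p.Gth)))
              + p.W2 * (Real.exp (-(p.W1 * p.Gth)) - Real.exp (-(p.W2 * p.Gth)))
                  / (p.W1 - p.W2)) ∧
        (∀ i : ℕ, m.outageProb (fun _ => 2 * p.M) i = Pout) ∧
        Tendsto (fun i : ℕ => m.outageProb (m.relayPower i) i) atTop (𝓝 Pout)) := by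
  refine ⟨fun h => ⟨_, rfl, p.intervalIntegrable_integrandHSU, ?_⟩, fun h => ⟨_, rfl, ?_⟩⟩
  · have hint := p.integral_bufferOutage hW (p.Z1_spec h).1
    simp only [RelayParams.nackProb, RelayParams.sumOutage] at hint
    rw [← hint]
    exact ⟨fun i hi => m.outageProb_eq_of_identDistrib h hi, m.tendsto_outageProb_of_one_lt h⟩
  · have hM := p.bufferOutage_M hW
    simp only [RelayParams.nackProb, RelayParams.sumOutage] at hM
    rw [← hM]
    exact ⟨fun i => m.outageProb_const i, m.tendsto_outageProb_of_le_one hW h⟩
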